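/- **Setting.** Let $\mu$ be a probability measure on $\mathbb R$, symmetric around $0$, with variance $1$ and with density $\exp(-\phi)$, where $\phi:\mathbb R\to\mathbb R$ satisfies, for constants $c,c_+>0$ and all $x,y\in\mathbb R$, $t\in(0,1)$, $$-\tfrac{c_+}{2}t(1-t)(x-y)^2\le \phi(tx+(1-t)y)-t\phi(x)-(1-t)\phi(y)\le -\tfrac{c}{2}t(1-t)(x-y)^2 .$$ Fix $\sigma>0$. For $d\ge1$ and $\theta\in\mathbb R^d$ let $P_\theta$ be the law of $\theta+\sigma\xi$, where $\xi$ has i.i.d. coordinates of law $\mu$. For $s\in\mathbb N$ and $a>0$ let $\Theta_d^+(s,a)$ (resp. $\Theta_d(s,a)$) be the set of $\theta\in\mathbb R^d$ for which there is $S\subseteq\{1,\dots,d\}$ with $|S|\le s$, $\theta_j\ge a$ (resp. $|\theta_j|\ge a$) for $j\in S$ and $\theta_j=0$ for $j\notin S$. Put $\eta(\theta)=(I(\theta_j\ne0))_{j\le d}$. A (coordinate-global, non-interactive) $\alpha$-locally differentially private mechanism is a family $Q=(Q^1,\dots,Q^n)$ of Markov kernels from $\mathbb R^d$ to $\mathbb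 R^d$ with $Q^i(A\mid x)\le e^{\alpha}Q^i(A\mid x')$ for all $i$, $x,x'$ and measurable $A$; $\mathcal Q_\alpha$ is the set of these. Given i.i.d. $X^1,\dots,X^n\sim P_\theta$, one observes $Z^i\sim Q^i(\cdot\mid X^i)$, $i\le n$, drawn independently of each other; $\mathbb E_{Q,\theta}$ denotes expectation for $(Z^1,\dots,Z^n)$. A selector is a measurable map $\hat\eta=\hat\eta(Z^1,\dots,Z^n)$ with values in $\{0,1\}^d$; it is separable, $\hat\eta\in\mathcal T$, if for each $j$ its $j$-th component depends only on $(Z^i_j)_{i\le n}$. Let $|\hat\eta-\eta|$ be the Hamming distance. Let $n=n_d$, $\alpha=\alpha_d$, $s=s_d$, $a=a_d$ depend on $d$. For a sequence of classes $\Theta_d$, exact recovery is *possible* if there are $Q\in\mathcal Q_\alpha$ and selectors $\hat\eta$ (for each $d$) with $$\lim_{d\to\infty}\ \sup_{\theta\in\Theta_d}\mathbb E_{Q,\theta}|\hat\eta-\eta(\theta)|=0,$$ and *impossible* if $$\liminf_{d\to\infty}\ \inf_{Q\in\mathcal Q_\alpha}\ \inf_{\hat\eta\in\mathcal T}\ \sup_{\theta\in\Theta_d}\mathbb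 E_{Q,\theta}|\hat\eta-\eta(\theta)|>0 .$$ **Statement.** Assume $1\le s_d\le d$ and $\alpha_d\in(0,1]$ for all $d\ge 1$, and $n\alpha^2/d\to+\infty$ with $(n\alpha^2/d)/\log d\to+\infty$ as $d\to\infty$. Set $$a^*=a^*_d=\frac{\sigma}{16L}\sqrt{\frac{d\log d}{n\alpha^2}},\qquad L=\frac{e^{2c_+}-1}{2}.$$ 1. For every sequence $a_d>0$ with $a_d\le a^*_d$ for all large $d$, exact recovery is impossible for $(\Theta_d^+(s_d,a_d))_d$ and for $(\Theta_d(s_d,a_d))_d$. 2. For every sequence $a_d>0$ with $a_d/a^*_d\to+\infty$, exact recovery is possible for $(\Theta_d^+(s_d,a_d))_d$ and for $(\Theta_d(s_d,a_d))_d$. -/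

import Mathlib

open MeasureTheory ProbabilityTheory Filter Topology
open scoped ENNReal

namespace PrivateSupport

/-- The law `μ` of one noise coordinate: a probability measure on `ℝ` with density `exp (-φ)`,
where the finite potential `φ` is `c`-strongly convex and has curvature at most `cp`
(`cp` stands for the constant `c₊`), symmetric around zero and of unit variance. -/
structure IsNoiseLaw (c cp : ℝ) (μ : Measure ℝ) : Prop where
  isProbability : IsProbabilityMeasure μ
  potential : ∃ φ : ℝ → ℝ,
    StrongConvexOn Set.univ c φ ∧
    (∀ x y t : ℝ, 0 < t → t < 1 →
      -(cp / 2) * t * (1 - t) * (x - y) ^ 2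
        ≤ φ (t * x + (1 - t) * y) - (t * φ x + (1 - t) * φ y)) ∧
    μ = volume.withDensity (fun x => ENNReal.ofReal (Real.exp (-φ x)))
  symmetric : μ.map (fun x => -x) = μ
  variance_eq_one : variance (fun x : ℝ => x) μ = 1

/-- The class `Θ_d⁺(s, a)`. -/
def sparsePos (d s : ℕ) (a : ℝ) : Set (Fin d → ℝ) :=
  {θ | ∃ S : Finset (Fin d), S.card ≤ s ∧ (∀ j ∈ S, a ≤ θ j) ∧ ∀ j ∉ S, θ j = 0}

/-- The class `Θ_d(s, a)`. -/
def sparseAbs (d s : ℕ) (a : ℝ) : Set (Fin d → ℝ) :=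
  {θ | ∃ S : Finset (Fin d), S.card ≤ s ∧ (∀ j ∈ S, a ≤ |θ j|) ∧ ∀ j ∉ S, θ j = 0}

open Classical in
/-- The vector `η = (I(θ_j ≠ 0))_j`, with values in `{false, true}` for `{0, 1}`. -/
noncomputable def supportVec {d : ℕ} (θ : Fin d → ℝ) : Fin d → Bool :=
  fun j => decide (θ j ≠ 0)

/-- The law `P_θ` of `X = θ + σ ξ`, where `ξ` has independent coordinates with law `μ`. -/
noncomputable def dataLaw (μ : Measure ℝ) (σ : ℝ) {d : ℕ} (θ : Fin d → ℝ) :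
    Measure (Fin d → ℝ) :=
  (Measure.pi (fun _ : Fin d => μ)).map (fun ξ => θ + σ • ξ)

/-- Coordinate global mechanisms: non-interactive `α`-locally differentially private
mechanisms `(Q¹, …, Qⁿ)` from `ℝᵈ` to `ℝᵈ`. -/
structure Mechanism (n d : ℕ) (α : ℝ) where
  kernel : Fin n → Kernel (Fin d → ℝ) (Fin d → ℝ)
  markov : ∀ i, IsMarkovKernel (kernel i)
  ldp : ∀ i, ∀ x x' : Fin d → ℝ, ∀ A : Set (Fin d → ℝ), MeasurableSet A →
    kernel i x A ≤ ENNReal.ofReal (Real.exp α) * kernel i x' A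

/-- The law `Q(P_θ^{⊗ n})` of `(Z¹, …, Zⁿ)`: the `Xⁱ` are i.i.d. with law `P_θ`, and
`Zⁱ ∼ Qⁱ(· ∣ Xⁱ)` depends on `Xⁱ` only. -/
noncomputable def releaseLaw (μ : Measure ℝ) (σ : ℝ) {n d : ℕ} {α : ℝ} (Q : Mechanism n d α)
    (θ : Fin d → ℝ) : Measure (Fin n → Fin d → ℝ) :=
  Measure.pi (fun i => (dataLaw μ σ θ).bind (Q.kernel i))

/-- A selector: a measurable `{0, 1}ᵈ`-valued function of `(Z¹, …, Zⁿ)`. -/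
structure Selector (n d : ℕ) where
  toFun : (Fin n → Fin d → ℝ) → (Fin d → Bool)
  measurable_toFun : Measurable toFun

/-- The `j`-th component depends only on `(Zⁱ_j)_i`. -/
def Selector.IsSeparable {n d : ℕ} (T : Selector n d) : Prop :=
  ∀ j : Fin d, ∀ z z' : Fin n → Fin d → ℝ, (∀ i, z i j = z' i j) → T.toFun z j = T.toFun z' j

/-- `sup_{θ ∈ Θ} E |η̂ - η|` with the Hamming loss. -/
noncomputable def maxRisk (μ : Measure ℝ) (σ : ℝ) {n d : ℕ} {α : ℝ} (Q : Mechanism n d α)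
    (T : Selector n d) (Θ : Set (Fin d → ℝ)) : ℝ≥0∞ :=
  ⨆ θ ∈ Θ, ∫⁻ z, (hammingDist (T.toFun z) (supportVec θ) : ℝ≥0∞) ∂(releaseLaw μ σ Q θ)

/-- `inf_Q inf_η̂ sup_{θ ∈ Θ} E |η̂ - η|` over mechanisms and separable selectors. -/
noncomputable def minimaxRisk (μ : Measure ℝ) (σ : ℝ) (n : ℕ) {d : ℕ} (α : ℝ)
    (Θ : Set (Fin d → ℝ)) : ℝ≥0∞ :=
  ⨅ (Q : Mechanism n d α) (T : Selector n d) (_ : T.IsSeparable), maxRisk μ σ Q T Θ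

/-- Exact recovery is possible for `(Θ_d)_d`, with `n d` data holders and privacy level `α d`. -/
def ExactRecoveryPossible (μ : Measure ℝ) (σ : ℝ) (n : ℕ → ℕ) (α : ℕ → ℝ)
    (Θ : ∀ d : ℕ, Set (Fin d → ℝ)) : Prop :=
  ∃ (Q : ∀ d, Mechanism (n d) d (α d)) (T : ∀ d, Selector (n d) d),
    Tendsto (fun d => maxRisk μ σ (Q d) (T d) (Θ d)) atTop (𝓝 0)

/-- Exact recovery is impossible for `(Θ_d)_d`. -/
def ExactRecoveryImpossible (μ : Measure ℝ) (σ : ℝ) (n : ℕ → ℕ) (α : ℕ → ℝ)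
    (Θ : ∀ d : ℕ, Set (Fin d → ℝ)) : Prop :=
  0 < liminf (fun d => minimaxRisk μ σ (n d) (α d) (Θ d)) atTop

/-- The critical value `a* = (σ / (16 L)) √(d log d / (n α²))`, `L = (exp (2 c₊) - 1) / 2`. -/
noncomputable def criticalValue (σ cp : ℝ) (n : ℕ) (α : ℝ) (d : ℕ) : ℝ :=
  σ / (16 * ((Real.exp (2 * cp) - 1) / 2)) * √((d : ℝ) * Real.log d / ((n : ℝ) * α ^ 2))

end PrivateSupport

open PrivateSupport

/-!
The critical value separates two regimes of the same per-coordinate information budget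
`n α² / d`, up to the factor `log d` that `d` simultaneous tests require.

Lower bound. The null mean `0` is compared with the `d` means `a eⱼ`. The density of an `α`-private
kernel, normalised by the law released under the null, differs from `1` by at most `exp α - 1`,
whereas the centred likelihood ratios of the `d` alternatives depend on different coordinates and are
orthogonal in `L²`. Bessel's inequality therefore bounds the *sum* over `j` of the `χ²`-divergences
of the released laws by `(exp α - 1)²` times the `χ²`-divergence of a single translate of the noise
(`exists_chiSq_bound_of_private`): the data holders cannot inform about all coordinates at once. The
curvature bound on the potential makes the latter divergence at most `exp (cp (a / σ)²) - 1`
(`IsNoiseLaw.exists_translate_density`), and unit variance forces `exp cp ≥ 2`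
(`IsNoiseLaw.two_le_exp`), so that the constant `L` is not small. Second moments of likelihood ratios
multiply over the data holders (`pi_withDensity_sq_le`). If the risk were below `1 / 4`, some
coordinate would have false-positive probability at most `1 / (2 d)` and total `χ²`-information at
most `log d`, and Cauchy–Schwarz would bound its squared detection probability by `1 / 2`
(`quarter_le_maxRisk`). The argument applies to all selectors, in particular to separable ones.

Upper bound. Each data holder is assigned one coordinate and spends the whole privacy budget on a
randomised response about its sign, so that about `n / d` answers concern each coordinate
(`responseMechanism`). The expected sign is `0` off the support and at least of the order of
`min (a / σ) 1` in absolute value on it (`IsNoiseLaw.exists_sign_mean_bound`). Thresholding the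
absolute value of the sum of the answers errs, by Hoeffding's inequality, with probability at most
`2 / d²` in each coordinate once `a` is far above the critical value (`maxRisk_response_le`).

Since the one-sided class is contained in the two-sided one, the lower bound is needed for the former
and the upper bound for the latter only.
-/

namespace PrivateSupport

/-! ### Product measures with densities -/

theorem lintegral_pi_prod {ι : Type*} [Fintype ι] {Z : ι → Type*} [∀ i, MeasurableSpace (Z i)]
    (μ : ∀ i, Measure (Z i)) [∀ i, IsProbabilityMeasure (μ i)] (f : ∀ i, Z i → ℝ≥0∞)
    (hf : ∀ i, Measurable (f i)) :
    ∫⁻ z, ∏ i, f i (z i) ∂(Measure.pi μ) = ∏ i, ∫⁻ x, f i x ∂(μ i) := by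
  rw [lintegral_prod_eq_prod_lintegral_of_indepFun Finset.univ (fun i (z : ∀ i, Z i) => f i (z i))
    (iIndepFun_pi fun i => (hf i).aemeasurable) (fun i => (hf i).comp (measurable_pi_apply i))]
  refine Finset.prod_congr rfl fun i _ => ?_
  exact (measurePreserving_eval μ i).lintegral_comp (hf i)

theorem pi_withDensity_eq {ι : Type*} [Fintype ι] {Z : ι → Type*} [∀ i, MeasurableSpace (Z i)]
    (μ : ∀ i, Measure (Z i)) [∀ i, IsProbabilityMeasure (μ i)] (f : ∀ i, Z i → ℝ≥0∞)
    (hf : ∀ i, Measurable (f i)) [∀ i, IsProbabilityMeasure ((μ i).withDensity (f i))] :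
    Measure.pi (fun i => (μ i).withDensity (f i))
      = (Measure.pi μ).withDensity (fun z => ∏ i, f i (z i)) := by
  refine Measure.pi_eq fun s hs => ?_
  rw [withDensity_apply _ (MeasurableSet.univ_pi hs), ← lintegral_indicator (.univ_pi hs)]
  have h : ∀ z : ∀ i, Z i, (Set.univ.pi s).indicator (fun z => ∏ i, f i (z i)) z
      = ∏ i, (s i).indicator (f i) (z i) := by
    intro z
    by_cases hz : z ∈ Set.univ.pi s
    · rw [Set.indicator_of_mem hz]
      exact Finset.prod_congr rfl fun i _ => (Set.indicator_of_mem (hz i trivial) _).symm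
    · rw [Set.indicator_of_notMem hz]
      simp only [Set.mem_univ_pi, not_forall] at hz
      obtain ⟨i, hi⟩ := hz
      exact (Finset.prod_eq_zero (Finset.mem_univ i) (Set.indicator_of_notMem hi _)).symm
  simp_rw [h]
  rw [lintegral_pi_prod μ _ fun i => (hf i).indicator (hs i)]
  refine Finset.prod_congr rfl fun i _ => ?_
  rw [lintegral_indicator (hs i), withDensity_apply _ (hs i)]

/-- Cauchy–Schwarz for the mass that a measure with a density gives to an event. -/
theorem withDensity_sq_le {Z : Type*} [MeasurableSpace Z] (μ : Measure Z) (f : Z → ℝ≥0∞)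
    (hf : Measurable f) {A : Set Z} (hA : MeasurableSet A) :
    (μ.withDensity f A) ^ 2 ≤ μ A * ∫⁻ z, f z ^ 2 ∂μ := by
  have h := ENNReal.lintegral_mul_le_Lp_mul_Lq (μ.restrict A) Real.HolderConjugate.two_two
    (f := f) (g := fun _ => 1) hf.aemeasurable aemeasurable_const
  simp only [Pi.mul_apply, mul_one, lintegral_const,
    Measure.restrict_apply, MeasurableSet.univ, Set.univ_inter, ENNReal.rpow_ofNat, one_pow, one_mul] at h
  rw [withDensity_apply _ hA]
  calc (∫⁻ z in A, f z ∂μ) ^ 2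
      ≤ ((∫⁻ z in A, f z ^ 2 ∂μ) ^ (1 / 2 : ℝ) * μ A ^ (1 / 2 : ℝ)) ^ 2 := by gcongr
    _ = (∫⁻ z in A, f z ^ 2 ∂μ) * μ A := by
        rw [mul_pow, ← ENNReal.rpow_mul_natCast, ← ENNReal.rpow_mul_natCast]
        norm_num
    _ ≤ μ A * ∫⁻ z, f z ^ 2 ∂μ := by
        rw [mul_comm]
        gcongr
        exact Measure.restrict_le_self

/-- The second moment of the likelihood ratio tensorises, so that it controls the power of every
test based on independent observations. -/
theorem pi_withDensity_sq_le {ι : Type*} [Fintype ι] {Z : ι → Type*} [∀ i, MeasurableSpace (Z i)]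
    (μ : ∀ i, Measure (Z i)) [∀ i, IsProbabilityMeasure (μ i)] (f : ∀ i, Z i → ℝ≥0∞)
    (hf : ∀ i, Measurable (f i)) [∀ i, IsProbabilityMeasure ((μ i).withDensity (f i))]
    {A : Set (∀ i, Z i)} (hA : MeasurableSet A) :
    (Measure.pi (fun i => (μ i).withDensity (f i)) A) ^ 2
      ≤ Measure.pi μ A * ∏ i, ∫⁻ x, f i x ^ 2 ∂(μ i) := by
  rw [pi_withDensity_eq μ f hf]
  have hm : Measurable fun z : ∀ i, Z i => ∏ i, f i (z i) :=
    Finset.measurable_prod _ fun i _ => (hf i).comp (measurable_pi_apply i)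
  refine (withDensity_sq_le _ _ hm hA).trans_eq ?_
  simp_rw [← Finset.prod_pow]
  rw [lintegral_pi_prod μ (fun i x => f i x ^ 2) fun i => (hf i).pow_const 2]

/-! ### Bessel's inequality -/

/-- Bessel's inequality for a bounded function `F` and an orthogonal family `g` in `L²(P)`. -/
theorem sum_sq_integral_mul_le {X ι : Type*} [MeasurableSpace X] [Fintype ι]
    (P : Measure X) [IsProbabilityMeasure P] (g : ι → X → ℝ) (hg : ∀ j, MemLp (g j) 2 P)
    {G K : ℝ} (hG : 0 < G) (horth : ∀ j k, j ≠ k → ∫ x, g j x * g k x ∂P = 0)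
    (hnorm : ∀ j, ∫ x, g j x * g j x ∂P ≤ G) (F : X → ℝ) (hF : Measurable F)
    (hFK : ∀ x, |F x| ≤ K) :
    ∑ j, (∫ x, F x * g j x ∂P) ^ 2 ≤ K ^ 2 * G := by
  have hint : ∀ j, Integrable (fun x => F x * g j x) P := fun j =>
    ((hg j).integrable one_le_two).bdd_mul hF.aestronglyMeasurable
      (Eventually.of_forall fun x => by simpa using hFK x)
  have hgg : ∀ j k, Integrable (fun x => g j x * g k x) P := fun j k =>
    (hg j).integrable_mul (hg k)
  set c : ι → ℝ := fun j => ∫ x, F x * g j x ∂P with hc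
  -- Compare `G • F` with the combination `u = ∑ cⱼ gⱼ`, whose squared norm is at most `G ∑ cⱼ²`.
  have hFu : ∫ x, F x * ∑ j, c j * g j x ∂P = ∑ j, c j ^ 2 := by
    have : ∀ x, F x * ∑ j, c j * g j x = ∑ j, c j * (F x * g j x) := fun x => by
      rw [Finset.mul_sum]; exact Finset.sum_congr rfl fun j _ => by ring
    simp_rw [this]
    rw [integral_finsetSum _ fun j _ => (hint j).const_mul _]
    refine Finset.sum_congr rfl fun j _ => ?_
    rw [integral_const_mul, sq]
  have hexp : ∀ x, (∑ j, c j * g j x) ^ 2 = ∑ j, ∑ k, c j * c k * (g j x * g k x) := fun x => by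
    rw [sq, Finset.sum_mul_sum]
    exact Finset.sum_congr rfl fun j _ => Finset.sum_congr rfl fun k _ => by ring
  have hu2 : Integrable (fun x => (∑ j, c j * g j x) ^ 2) P := by
    simp_rw [hexp]
    exact integrable_finsetSum _ fun j _ => integrable_finsetSum _ fun k _ =>
      (hgg j k).const_mul _
  have huu : ∫ x, (∑ j, c j * g j x) ^ 2 ∂P ≤ G * ∑ j, c j ^ 2 := by
    simp_rw [hexp]
    rw [integral_finsetSum _ fun j _ => integrable_finsetSum _ fun k _ => (hgg j k).const_mul _,
      Finset.mul_sum]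
    refine Finset.sum_le_sum fun j _ => ?_
    rw [integral_finsetSum _ fun k _ => (hgg j k).const_mul _, Finset.sum_eq_single j]
    · rw [integral_const_mul]
      nlinarith [hnorm j, sq_nonneg (c j)]
    · intro k _ hkj
      rw [integral_const_mul, horth j k hkj.symm, mul_zero]
    · simp
  have hle : ∫ x, 2 * G * (F x * ∑ j, c j * g j x) ∂P
      ≤ ∫ x, ((G * K) ^ 2 + (∑ j, c j * g j x) ^ 2) ∂P := by
    refine integral_mono ?_ ((integrable_const _).add hu2) fun x => ?_
    · refine Integrable.const_mul ?_ _
      simp_rw [Finset.mul_sum]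
      refine integrable_finsetSum _ fun j _ => ?_
      simpa only [mul_left_comm] using (hint j).const_mul (c j)
    · have h1 : F x ^ 2 ≤ K ^ 2 := sq_le_sq.2 ((hFK x).trans (le_abs_self K))
      have h2 : (G * F x) ^ 2 ≤ (G * K) ^ 2 := by
        rw [mul_pow, mul_pow]; gcongr
      dsimp only
      nlinarith [sq_nonneg (G * F x - ∑ j, c j * g j x)]
  rw [integral_const_mul, hFu, integral_add (integrable_const _) hu2] at hle
  simp only [integral_const, probReal_univ, one_smul] at hle
  have : G * ∑ j, c j ^ 2 ≤ G * (K ^ 2 * G) := by nlinarith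
  exact le_of_mul_le_mul_left this hG

/-! ### Likelihood ratios of the releases of a private kernel -/

/-- A private kernel has jointly measurable densities with respect to any measure that it
dominates and that dominates it, and the privacy bounds can be imposed on them everywhere. -/
theorem exists_density_of_le_mul {X Z : Type*} [MeasurableSpace X] [MeasurableSpace Z]
    [MeasurableSpace.CountableOrCountablyGenerated X Z] (κ : Kernel X Z) [IsMarkovKernel κ]
    (M : Measure Z) [IsProbabilityMeasure M] {α : ℝ} (hα : 0 ≤ α)
    (h1 : ∀ x A, MeasurableSet A → κ x A ≤ ENNReal.ofReal (Real.exp α) * M A)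
    (h2 : ∀ x A, MeasurableSet A → M A ≤ ENNReal.ofReal (Real.exp α) * κ x A) :
    ∃ f : X → Z → ℝ, Measurable (Function.uncurry f) ∧ (∀ x z, 0 ≤ f x z) ∧
      (∀ x z, |f x z - 1| ≤ Real.exp α - 1) ∧
      ∀ x, κ x = M.withDensity (fun z => ENNReal.ofReal (f x z)) := by
  set c := ENNReal.ofReal (Real.exp α) with hc
  set k := Kernel.rnDeriv κ (Kernel.const X M) with hk
  have hkm : Measurable (Function.uncurry k) := Kernel.measurable_rnDeriv _ _
  have hkx : ∀ x, Measurable (k x) := fun x => hkm.of_uncurry_left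
  have hac : ∀ x, κ x ≪ Kernel.const X M x := fun x => by
    refine Measure.AbsolutelyContinuous.mk fun s hs h0 => ?_
    rw [Kernel.const_apply] at h0
    simpa [h0] using h1 x s hs
  have hκ : ∀ x, κ x = M.withDensity (k x) := fun x => by
    have := Kernel.withDensity_rnDeriv_eq (hac x)
    rw [Kernel.withDensity_apply _ (Kernel.measurable_rnDeriv _ _), Kernel.const_apply] at this
    exact this.symm
  have hup : ∀ x, ∀ᵐ z ∂M, k x z ≤ c := fun x => by
    refine ae_le_of_forall_setLIntegral_le_of_sigmaFinite (hkx x) fun s hs _ => ?_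
    rw [setLIntegral_const, ← withDensity_apply _ hs, ← hκ]
    exact h1 x s hs
  have hlo : ∀ x, ∀ᵐ z ∂M, 1 ≤ c * k x z := fun x => by
    refine ae_le_of_forall_setLIntegral_le_of_sigmaFinite measurable_const fun s hs _ => ?_
    rw [setLIntegral_const, one_mul, lintegral_const_mul _ (hkx x), ← withDensity_apply _ hs, ← hκ]
    exact h2 x s hs
  have he : 1 ≤ Real.exp α := Real.one_le_exp hα
  have hinv : Real.exp (-α) * Real.exp α = 1 := by rw [← Real.exp_add]; simp
  have hpos := Real.exp_pos (-α)
  refine ⟨fun x z => max (Real.exp (-α)) (min (Real.exp α) (k x z).toReal), ?_, ?_, ?_, ?_⟩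
  · exact measurable_const.max (measurable_const.min hkm.ennreal_toReal)
  · exact fun x z => hpos.le.trans (le_max_left _ _)
  · intro x z
    rw [abs_le]
    constructor
    · have := le_max_left (Real.exp (-α)) (min (Real.exp α) (k x z).toReal)
      nlinarith [sq_nonneg (Real.exp α - 1)]
    · have : max (Real.exp (-α)) (min (Real.exp α) (k x z).toReal) ≤ Real.exp α :=
        max_le (by nlinarith) (min_le_left _ _)
      linarith
  · intro x
    rw [hκ x]
    refine withDensity_congr_ae ?_
    filter_upwards [hup x, hlo x] with z hz1 hz2
    have hfin : k x z ≠ ∞ := (hz1.trans_lt ENNReal.ofReal_lt_top).ne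
    have hz1' : (k x z).toReal ≤ Real.exp α :=
      ENNReal.toReal_le_of_le_ofReal (Real.exp_pos α).le hz1
    have hz2' : 1 ≤ Real.exp α * (k x z).toReal := by
      have := ENNReal.toReal_mono (ENNReal.mul_ne_top ENNReal.ofReal_ne_top hfin) hz2
      rwa [ENNReal.toReal_one, ENNReal.toReal_mul, ENNReal.toReal_ofReal (Real.exp_pos α).le]
        at this
    have hz3 : Real.exp (-α) ≤ (k x z).toReal := by nlinarith
    rw [min_eq_right hz1', max_eq_right hz3, ENNReal.ofReal_toReal hfin]

/-- Information contraction for a private kernel. If the laws with densities `r j` with respect to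
`P` have pairwise orthogonal centred densities, then the `χ²`-divergences `V j` of the released laws
are small *in total*: for every outcome `z` the centred channel density is bounded by
`exp α - 1`, and Bessel's inequality bounds the sum over `j` of its squared correlations with
`r j - 1`. -/
theorem exists_chiSq_bound_of_private {X Z ι : Type*} [MeasurableSpace X] [MeasurableSpace Z]
    [Fintype ι] [MeasurableSpace.CountableOrCountablyGenerated X Z]
    (κ : Kernel X Z) [IsMarkovKernel κ] {α : ℝ} (hα : 0 ≤ α)
    (hκ : ∀ x x' A, MeasurableSet A → κ x A ≤ ENNReal.ofReal (Real.exp α) * κ x' A)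
    (P : Measure X) [IsProbabilityMeasure P] (r : ι → X → ℝ) (hrm : ∀ j, Measurable (r j))
    (hr0 : ∀ j x, 0 ≤ r j x) (hr1 : ∀ j, ∫ x, r j x ∂P = 1)
    (hr2 : ∀ j, MemLp (fun x => r j x - 1) 2 P) {G : ℝ} (hG : 0 < G)
    (horth : ∀ j k, j ≠ k → ∫ x, (r j x - 1) * (r k x - 1) ∂P = 0)
    (hnorm : ∀ j, ∫ x, (r j x - 1) * (r j x - 1) ∂P ≤ G) :
    ∃ (h : ι → Z → ℝ≥0∞) (V : ι → ℝ), (∀ j, Measurable (h j)) ∧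
      (∀ j, (P.withDensity (fun x => ENNReal.ofReal (r j x))).bind κ
        = (P.bind κ).withDensity (h j)) ∧
      (∀ j, ∫⁻ z, h j z ^ 2 ∂(P.bind κ) ≤ ENNReal.ofReal (1 + V j)) ∧
      (∀ j, 0 ≤ V j) ∧ ∑ j, V j ≤ (Real.exp α - 1) ^ 2 * G := by
  set M := P.bind κ with hM
  have hMp : IsProbabilityMeasure M := by rw [hM]; infer_instance
  have hMA : ∀ A, MeasurableSet A → M A = ∫⁻ x, κ x A ∂P := fun A hA =>
    Measure.bind_apply hA κ.measurable.aemeasurable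
  obtain ⟨f, hfm, hf0, hfK, hfκ⟩ := exists_density_of_le_mul κ M hα
    (fun x A hA => by
      rw [hMA A hA, ← lintegral_const_mul' _ _ ENNReal.ofReal_ne_top]
      calc κ x A = ∫⁻ _, κ x A ∂P := by simp
        _ ≤ _ := lintegral_mono fun y => hκ x y A hA)
    (fun x A hA => by
      rw [hMA A hA]
      calc ∫⁻ y, κ y A ∂P ≤ ∫⁻ _, ENNReal.ofReal (Real.exp α) * κ x A ∂P :=
            lintegral_mono fun y => hκ y x A hA
        _ = _ := by simp)
  set K := Real.exp α - 1 with hK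
  have hfz : ∀ z, Measurable fun x => f x z := fun z => hfm.of_uncurry_right
  have hfint : ∀ z, Integrable (fun x => f x z - 1) P := fun z =>
    Integrable.of_bound (((hfz z).sub_const 1).aestronglyMeasurable) K
      (Eventually.of_forall fun x => by simpa using hfK x z)
  have hfint' : ∀ z, Integrable (fun x => f x z) P := fun z =>
    ((hfint z).add (integrable_const (1 : ℝ))).congr (Eventually.of_forall fun x => by simp)
  have hrint : ∀ j, Integrable (r j) P := fun j =>
    (((hr2 j).integrable one_le_two).add (integrable_const (1 : ℝ))).congr
      (Eventually.of_forall fun x => by simp)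
  have hprod : ∀ j z, Integrable (fun x => (f x z - 1) * (r j x - 1)) P := fun j z =>
    ((hr2 j).integrable one_le_two).bdd_mul ((hfz z).sub_const 1).aestronglyMeasurable
      (Eventually.of_forall fun x => by simpa using hfK x z)
  have hprod' : ∀ j z, Integrable (fun x => r j x * f x z) P := fun j z => by
    have := ((hprod j z).add (hfint' z)).add ((hrint j).sub (integrable_const 1))
    refine this.congr (Eventually.of_forall fun x => ?_)
    simp only [Pi.add_apply, Pi.sub_apply]; ring
  -- The law released from `P` reweighted by `p` has density `z ↦ ∫ p(x) f(x, z) P(dx)`.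
  have key : ∀ p : X → ℝ, Measurable p → (∀ x, 0 ≤ p x) →
      (∀ z, Integrable (fun x => p x * f x z) P) →
      (P.withDensity (fun x => ENNReal.ofReal (p x))).bind κ
        = M.withDensity (fun z => ENNReal.ofReal (∫ x, p x * f x z ∂P)) := by
    intro p hp hp0 hpi
    ext A hA
    have hm2 : Measurable (Function.uncurry fun x z =>
        ENNReal.ofReal (p x) * ENNReal.ofReal (f x z)) :=
      (hp.comp measurable_fst).ennreal_ofReal.mul hfm.ennreal_ofReal
    rw [Measure.bind_apply hA κ.measurable.aemeasurable,
      lintegral_withDensity_eq_lintegral_mul _ hp.ennreal_ofReal (κ.measurable_coe hA),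
      withDensity_apply _ hA]
    calc ∫⁻ x, ENNReal.ofReal (p x) * κ x A ∂P
        = ∫⁻ x, ∫⁻ z in A, ENNReal.ofReal (p x) * ENNReal.ofReal (f x z) ∂M ∂P := by
          refine lintegral_congr fun x => ?_
          rw [lintegral_const_mul' _ _ ENNReal.ofReal_ne_top, hfκ x, withDensity_apply _ hA]
      _ = ∫⁻ z in A, ∫⁻ x, ENNReal.ofReal (p x) * ENNReal.ofReal (f x z) ∂P ∂M :=
          lintegral_lintegral_swap hm2.aemeasurable
      _ = _ := by
          refine lintegral_congr fun z => ?_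
          rw [ofReal_integral_eq_lintegral_ofReal (hpi z)
            (Eventually.of_forall fun x => mul_nonneg (hp0 x) (hf0 x z))]
          exact lintegral_congr fun x => (ENNReal.ofReal_mul (hp0 x)).symm
  have hmeas : ∀ p : X → ℝ, Measurable p → Measurable fun z => ∫ x, p x * f x z ∂P := by
    intro p hp
    have : Measurable (Function.uncurry fun z x => p x * f x z) :=
      (hp.comp measurable_snd).mul (hfm.comp measurable_swap)
    exact this.stronglyMeasurable.integral_prod_right'.measurable
  -- Without reweighting the density is `1`.
  have hC : ∀ᵐ z ∂M, ∫ x, f x z ∂P = 1 := by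
    have h0 := key (fun _ => 1) measurable_const (fun _ => zero_le_one)
      (fun z => by simpa using hfint' z)
    have h0m := hmeas (fun _ => 1) measurable_const
    simp only [ENNReal.ofReal_one, one_mul] at h0 h0m
    rw [show P.withDensity (fun _ => (1 : ℝ≥0∞)) = P from withDensity_one, ← hM] at h0
    have h0' : M.withDensity (fun _ => 1)
        = M.withDensity (fun z => ENNReal.ofReal (∫ x, f x z ∂P)) := by
      rw [← h0]; exact withDensity_one
    have := (withDensity_eq_iff_of_sigmaFinite measurable_const.aemeasurable
      h0m.ennreal_ofReal.aemeasurable).1 h0'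
    filter_upwards [this] with z hz
    exact (ENNReal.ofReal_eq_one.1 hz.symm)
  set D : ι → Z → ℝ := fun j z => ∫ x, (f x z - 1) * (r j x - 1) ∂P with hD
  have hDm : ∀ j, Measurable (D j) := by
    intro j
    have : Measurable (Function.uncurry fun z x => (f x z - 1) * (r j x - 1)) :=
      ((hfm.comp measurable_swap).sub_const 1).mul (((hrm j).comp measurable_snd).sub_const 1)
    exact this.stronglyMeasurable.integral_prod_right'.measurable
  have hbessel : ∀ z, ∑ j, D j z ^ 2 ≤ K ^ 2 * G := fun z =>
    sum_sq_integral_mul_le P (fun j x => r j x - 1) hr2 hG horth hnorm (fun x => f x z - 1)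
      ((hfz z).sub_const 1) (hfK · z)
  have hDH : ∀ j, ∀ᵐ z ∂M, ∫ x, r j x * f x z ∂P = 1 + D j z := by
    intro j
    filter_upwards [hC] with z hz
    have h1 : D j z = ∫ x, (r j x * f x z - f x z - (r j x - 1)) ∂P :=
      integral_congr_ae (Eventually.of_forall fun x => by ring)
    have hi : Integrable (fun x => r j x * f x z - f x z) P := (hprod' j z).sub (hfint' z)
    rw [h1, integral_sub hi ((hr2 j).integrable one_le_two),
      integral_sub (hprod' j z) (hfint' z), integral_sub (hrint j) (integrable_const _), hz, hr1 j]
    simp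
  have hDle : ∀ j z, D j z ^ 2 ≤ K ^ 2 * G := fun j z =>
    (Finset.single_le_sum (f := fun j => D j z ^ 2) (fun j _ => sq_nonneg _)
      (Finset.mem_univ j)).trans (hbessel z)
  have hD2i : ∀ j, Integrable (fun z => D j z ^ 2) M := fun j =>
    Integrable.of_bound ((hDm j).pow_const 2).aestronglyMeasurable (K ^ 2 * G)
      (Eventually.of_forall fun z => by
        rw [Real.norm_eq_abs, abs_of_nonneg (sq_nonneg _)]; exact hDle j z)
  have hDi : ∀ j, Integrable (D j) M := fun j =>
    ((memLp_two_iff_integrable_sq (hDm j).aestronglyMeasurable).2 (hD2i j)).integrable one_le_two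
  have hkey : ∀ j, (P.withDensity (fun x => ENNReal.ofReal (r j x))).bind κ
      = M.withDensity (fun z => ENNReal.ofReal (∫ x, r j x * f x z ∂P)) := fun j =>
    key (r j) (hrm j) (hr0 j) (hprod' j)
  -- The released laws are probability measures, so `D j` is centred.
  have hD0 : ∀ j, ∫ z, D j z ∂M = 0 := by
    intro j
    have hp : IsProbabilityMeasure (P.withDensity (fun x => ENNReal.ofReal (r j x))) := by
      constructor
      rw [withDensity_apply _ .univ, Measure.restrict_univ,
        ← ofReal_integral_eq_lintegral_ofReal (hrint j) (Eventually.of_forall (hr0 j)), hr1 j,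
        ENNReal.ofReal_one]
    have h1 : (M.withDensity (fun z => ENNReal.ofReal (∫ x, r j x * f x z ∂P))) Set.univ = 1 := by
      rw [← hkey j]; exact measure_univ
    rw [withDensity_apply _ .univ, Measure.restrict_univ,
      ← ofReal_integral_eq_lintegral_ofReal _ (Eventually.of_forall fun z =>
        integral_nonneg fun x => mul_nonneg (hr0 j x) (hf0 x z)), ENNReal.ofReal_eq_one,
      integral_congr_ae (hDH j), integral_add (integrable_const _) (hDi j)] at h1
    · simpa using h1
    · exact ((integrable_const 1).add (hDi j)).congr ((hDH j).mono fun z hz => hz.symm)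
  refine ⟨fun j z => ENNReal.ofReal (∫ x, r j x * f x z ∂P), fun j => ∫ z, D j z ^ 2 ∂M,
    fun j => (hmeas _ (hrm j)).ennreal_ofReal, hkey, fun j => ?_,
    fun j => integral_nonneg fun z => sq_nonneg _, ?_⟩
  · have h1 : ∫ z, (1 + D j z) ^ 2 ∂M = 1 + ∫ z, D j z ^ 2 ∂M := by
      have : ∀ z, (1 + D j z) ^ 2 = 1 + 2 * D j z + D j z ^ 2 := fun z => by ring
      have hi : Integrable (fun z => 1 + 2 * D j z) M :=
        (integrable_const _).add ((hDi j).const_mul 2)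
      simp_rw [this]
      rw [integral_add hi (hD2i j),
        integral_add (integrable_const _) ((hDi j).const_mul 2), integral_const_mul, hD0 j]
      simp
    have hi : Integrable (fun z => (1 + D j z) ^ 2) M := by
      have := ((integrable_const 1).add ((hDi j).const_mul 2)).add (hD2i j)
      refine this.congr (Eventually.of_forall fun z => ?_)
      simp only [Pi.add_apply]; ring
    rw [← h1, ofReal_integral_eq_lintegral_ofReal hi (Eventually.of_forall fun z => sq_nonneg _)]
    refine (lintegral_congr_ae ?_).le
    filter_upwards [hDH j] with z hz
    rw [← hz, ENNReal.ofReal_pow (integral_nonneg fun x => mul_nonneg (hr0 j x) (hf0 x z))]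
  · rw [← integral_finsetSum _ fun j _ => hD2i j]
    calc ∫ z, ∑ j, D j z ^ 2 ∂M ≤ ∫ _, K ^ 2 * G ∂M :=
          integral_mono (integrable_finsetSum _ fun j _ => hD2i j) (integrable_const _) hbessel
      _ = _ := by simp

/-! ### Translates of the noise law -/

/-- A translate of the noise law has a square integrable density `r` with respect to the noise law,
and the upper curvature bound on the potential controls the `χ²`-divergence: applied at the midpoint
of `x` and `x - 2b` it gives `φ(x) - 2φ(x - b) ≤ -φ(x - 2b) + cp b²`. -/
theorem IsNoiseLaw.exists_translate_density {c cp : ℝ} {μ : Measure ℝ} (hc : 0 < c)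
    (hμ : IsNoiseLaw c cp μ) (b : ℝ) :
    ∃ r : ℝ → ℝ, Measurable r ∧ (∀ x, 0 ≤ r x) ∧
      μ.map (fun x => x + b) = μ.withDensity (fun x => ENNReal.ofReal (r x)) ∧
      MemLp (fun x => r x - 1) 2 μ ∧ ∫ x, r x ∂μ = 1 ∧
      ∫ x, (r x - 1) * (r x - 1) ∂μ ≤ Real.exp (cp * b ^ 2) - 1 := by
  have hprob := hμ.isProbability
  obtain ⟨φ, hφc, hφs, hφ⟩ := hμ.potential
  have hcont : Continuous φ := by
    rw [← continuousOn_univ]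
    exact (hφc.convexOn fun r => by positivity).continuousOn isOpen_univ
  have hEm : Measurable fun x => ENNReal.ofReal (Real.exp (-φ x)) := by fun_prop
  have hμA : ∀ A, MeasurableSet A → μ A = ∫⁻ x in A, ENNReal.ofReal (Real.exp (-φ x)) := by
    intro A hA
    conv_lhs => rw [hφ]
    exact withDensity_apply _ hA
  have hone : ∫⁻ x, ENNReal.ofReal (Real.exp (-φ x)) = 1 := by
    rw [← setLIntegral_univ, ← hμA _ .univ]; exact measure_univ
  have hr0 : ∀ x, 0 ≤ Real.exp (φ x - φ (x - b)) := fun x => (Real.exp_pos _).le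
  have hrm : Measurable fun x => Real.exp (φ x - φ (x - b)) := by fun_prop
  have hlint : ∀ g : ℝ → ℝ≥0∞, Measurable g →
      ∫⁻ x, g x ∂μ = ∫⁻ x, ENNReal.ofReal (Real.exp (-φ x)) * g x := by
    intro g hg
    conv_lhs => rw [hφ]
    exact lintegral_withDensity_eq_lintegral_mul _ hEm hg
  have hmap : μ.map (fun x => x + b)
      = μ.withDensity (fun x => ENNReal.ofReal (Real.exp (φ x - φ (x - b)))) := by
    ext A hA
    rw [Measure.map_apply (by fun_prop) hA, withDensity_apply _ hA,
      ← lintegral_indicator hA, hlint _ (hrm.ennreal_ofReal.indicator hA),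
      hμA _ (hA.preimage (by fun_prop)),
      ← lintegral_indicator (hA.preimage (by fun_prop)),
      ← lintegral_sub_right_eq_self _ b]
    refine lintegral_congr fun x => ?_
    by_cases hx : x ∈ A
    · rw [Set.indicator_of_mem hx, Set.indicator_of_mem (by simpa using hx),
        ← ENNReal.ofReal_mul (Real.exp_pos _).le, ← Real.exp_add]
      congr 2; ring
    · rw [Set.indicator_of_notMem hx, Set.indicator_of_notMem (by simpa using hx), mul_zero]
  have hsq : ∫⁻ x, ENNReal.ofReal (Real.exp (φ x - φ (x - b)) ^ 2) ∂μ
      ≤ ENNReal.ofReal (Real.exp (cp * b ^ 2)) := by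
    rw [hlint _ (by fun_prop)]
    calc ∫⁻ x, ENNReal.ofReal (Real.exp (-φ x))
          * ENNReal.ofReal (Real.exp (φ x - φ (x - b)) ^ 2)
        ≤ ∫⁻ x, ENNReal.ofReal (Real.exp (cp * b ^ 2))
          * ENNReal.ofReal (Real.exp (-φ (x - 2 * b))) := by
          refine lintegral_mono fun x => ?_
          rw [← ENNReal.ofReal_mul (Real.exp_pos _).le, ← ENNReal.ofReal_mul (Real.exp_pos _).le]
          refine ENNReal.ofReal_le_ofReal ?_
          rw [← Real.exp_nat_mul, ← Real.exp_add, ← Real.exp_add]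
          refine Real.exp_le_exp.2 ?_
          have h := hφs x (x - 2 * b) (1 / 2) (by norm_num) (by norm_num)
          rw [show (1 / 2 : ℝ) * x + (1 - 1 / 2) * (x - 2 * b) = x - b by ring] at h
          push_cast
          nlinarith
      _ = ENNReal.ofReal (Real.exp (cp * b ^ 2)) := by
          rw [lintegral_const_mul' _ _ ENNReal.ofReal_ne_top,
            lintegral_sub_right_eq_self (fun x => ENNReal.ofReal (Real.exp (-φ x))) (2 * b), hone,
            mul_one]
  have hi2 : Integrable (fun x => Real.exp (φ x - φ (x - b)) ^ 2) μ := by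
    refine ⟨(hrm.pow_const 2).aestronglyMeasurable, ?_⟩
    rw [hasFiniteIntegral_iff_ofReal (Eventually.of_forall fun x => sq_nonneg _)]
    exact hsq.trans_lt ENNReal.ofReal_lt_top
  have hmem : MemLp (fun x => Real.exp (φ x - φ (x - b))) 2 μ :=
    (memLp_two_iff_integrable_sq hrm.aestronglyMeasurable).2 hi2
  have hint := hmem.integrable one_le_two
  have hr1 : ∫ x, Real.exp (φ x - φ (x - b)) ∂μ = 1 := by
    have h1 : (μ.map (fun x => x + b)) Set.univ = 1 := by
      rw [Measure.map_apply (by fun_prop) .univ, Set.preimage_univ, measure_univ]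
    rwa [hmap, withDensity_apply _ .univ, Measure.restrict_univ,
      ← ofReal_integral_eq_lintegral_ofReal hint (Eventually.of_forall hr0),
      ENNReal.ofReal_eq_one] at h1
  refine ⟨fun x => Real.exp (φ x - φ (x - b)), hrm, hr0, hmap, hmem.sub (memLp_const 1), hr1, ?_⟩
  have h1 : ∀ x, (Real.exp (φ x - φ (x - b)) - 1) * (Real.exp (φ x - φ (x - b)) - 1)
      = Real.exp (φ x - φ (x - b)) ^ 2 - (2 * Real.exp (φ x - φ (x - b)) - 1) := fun x => by ring
  simp_rw [h1]
  have hi3 : Integrable (fun x => 2 * Real.exp (φ x - φ (x - b)) - 1) μ :=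
    (hint.const_mul 2).sub (integrable_const 1)
  rw [integral_sub hi2 hi3, integral_sub (hint.const_mul 2) (integrable_const 1),
    integral_const_mul, hr1]
  have h2 : ∫ x, Real.exp (φ x - φ (x - b)) ^ 2 ∂μ ≤ Real.exp (cp * b ^ 2) := by
    rw [← ofReal_integral_eq_lintegral_ofReal hi2 (Eventually.of_forall fun x => sq_nonneg _)]
      at hsq
    exact (ENNReal.ofReal_le_ofReal_iff (Real.exp_pos _).le).1 hsq
  simp only [integral_const, probReal_univ, one_smul]
  linarith

/-- A noise law of unit variance cannot have a small curvature bound: translating by `1` moves the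
mean by `1`, which costs a `χ²`-divergence of at least `1`. -/
theorem IsNoiseLaw.two_le_exp {c cp : ℝ} {μ : Measure ℝ} (hc : 0 < c)
    (hμ : IsNoiseLaw c cp μ) : 2 ≤ Real.exp cp := by
  have hprob := hμ.isProbability
  obtain ⟨r, hrm, hr0, hmap, hr2, hr1, hchi⟩ := hμ.exists_translate_density hc 1
  have hid : MemLp (fun x : ℝ => x) 2 μ := by
    by_contra h
    have := hμ.variance_eq_one
    rw [variance, evariance_eq_top measurable_id'.aestronglyMeasurable h] at this
    simp at this
  set m := ∫ x, x ∂μ with hm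
  have hidm : MemLp (fun x : ℝ => x - m) 2 μ := hid.sub (memLp_const m)
  have hvar : ∫ x, (x - m) ^ 2 ∂μ = 1 := by
    rw [← hμ.variance_eq_one, variance_eq_integral measurable_id'.aemeasurable]
  have hc0 : ∫ x, (x - m) ∂μ = 0 := by
    rw [integral_sub (hid.integrable one_le_two) (integrable_const _)]; simp [hm]
  have hcr : Integrable (fun x => (x - m) * (r x - 1)) μ := hidm.integrable_mul hr2
  have hshift : ∫ x, r x * (x - m) ∂μ = 1 := by
    have h1 : ∫ x, (x - m) ∂(μ.map (fun x => x + 1)) = 1 := by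
      rw [integral_map (by fun_prop) (by fun_prop)]
      have : ∀ x : ℝ, x + 1 - m = (x - m) + 1 := fun x => by ring
      simp_rw [this]
      rw [integral_add (hidm.integrable one_le_two) (integrable_const _), hc0]; simp
    rw [hmap, integral_withDensity_eq_integral_toReal_smul hrm.ennreal_ofReal
      (Eventually.of_forall fun x => ENNReal.ofReal_lt_top)] at h1
    rw [← h1]
    refine integral_congr_ae (Eventually.of_forall fun x => ?_)
    simp [ENNReal.toReal_ofReal (hr0 x)]
  have hcov : ∫ x, (x - m) * (r x - 1) ∂μ = 1 := by
    have h1 : Integrable (fun x => r x * (x - m)) μ := by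
      refine (hcr.add (hidm.integrable one_le_two)).congr (Eventually.of_forall fun x => ?_)
      simp only [Pi.add_apply]; ring
    calc ∫ x, (x - m) * (r x - 1) ∂μ = ∫ x, (r x * (x - m) - (x - m)) ∂μ :=
          integral_congr_ae (Eventually.of_forall fun x => by ring)
      _ = 1 := by rw [integral_sub h1 (hidm.integrable one_le_two), hshift, hc0, sub_zero]
  have hle : ∫ x, 2 * ((x - m) * (r x - 1)) ∂μ
      ≤ ∫ x, ((x - m) ^ 2 + (r x - 1) * (r x - 1)) ∂μ :=
    integral_mono (hcr.const_mul 2) (hidm.integrable_sq.add (hr2.integrable_mul hr2)) fun x => by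
      dsimp only
      nlinarith [sq_nonneg ((x - m) - (r x - 1))]
  have hrr : Integrable (fun x => (r x - 1) * (r x - 1)) μ := hr2.integrable_mul hr2
  rw [integral_const_mul, hcov, integral_add hidm.integrable_sq hrr, hvar] at hle
  norm_num at hchi
  linarith

/-! ### Sparse means -/

theorem dataLaw_zero (μ : Measure ℝ) (σ : ℝ) (d : ℕ) :
    dataLaw μ σ (0 : Fin d → ℝ) = (Measure.pi (fun _ : Fin d => μ)).map (fun ξ => σ • ξ) := by
  simp [dataLaw]

/-- Moving one coordinate of the mean reweights the noise by the density of a translate. -/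
theorem dataLaw_single (μ : Measure ℝ) [IsProbabilityMeasure μ] {σ : ℝ} (hσ : σ ≠ 0) {d : ℕ}
    (j : Fin d) (a : ℝ) (r : ℝ → ℝ) (hrm : Measurable r)
    (hr : μ.map (fun x => x + a / σ) = μ.withDensity (fun x => ENNReal.ofReal (r x))) :
    dataLaw μ σ (Pi.single j a) = ((Measure.pi (fun _ : Fin d => μ)).withDensity
      (fun x => ENNReal.ofReal (r (x j)))).map (fun ξ => σ • ξ) := by
  classical
  set F : Fin d → ℝ → ℝ≥0∞ := fun i x => if i = j then ENNReal.ofReal (r x) else 1 with hF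
  have hFm : ∀ i, Measurable (F i) := fun i => by
    by_cases hi : i = j
    · simp only [hF, hi, if_true]; exact hrm.ennreal_ofReal
    · simp only [hF, hi, if_false]; exact measurable_const
  have hmap : ∀ i, μ.map (fun x => x + (Pi.single j (a / σ) : Fin d → ℝ) i)
      = μ.withDensity (F i) := fun i => by
    by_cases hi : i = j
    · subst hi
      simp only [hF, if_true, Pi.single_eq_same, hr]
    · simp only [hF, hi, if_false, Pi.single_eq_of_ne hi, add_zero]
      rw [Measure.map_id']
      exact withDensity_one.symm
  have hpr : ∀ i, IsProbabilityMeasure (μ.withDensity (F i)) := fun i => by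
    rw [← hmap i]; exact Measure.isProbabilityMeasure_map (by fun_prop)
  have hpr' : ∀ i, IsProbabilityMeasure
      (μ.map (fun x => x + (Pi.single j (a / σ) : Fin d → ℝ) i)) := fun i =>
    Measure.isProbabilityMeasure_map (by fun_prop)
  have hprod : ∀ x : Fin d → ℝ, ∏ i, F i (x i) = ENNReal.ofReal (r (x j)) := fun x => by
    simp [hF, Finset.prod_ite_eq']
  have hpi := pi_withDensity_eq (fun _ : Fin d => μ) F hFm
  simp_rw [hprod] at hpi
  rw [← hpi]
  simp_rw [← hmap]
  rw [← Measure.pi_map_pi (μ := fun _ : Fin d => μ)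
    (f := fun i x => x + (Pi.single j (a / σ) : Fin d → ℝ) i) (fun i => by fun_prop),
    Measure.map_map (by fun_prop) (by fun_prop), dataLaw]
  congr 1
  ext ξ i
  by_cases hi : i = j
  · subst hi
    simp; field_simp; ring
  · simp [Pi.single_eq_of_ne hi]

theorem bind_map_eq_bind_comap {X Y Z : Type*} [MeasurableSpace X] [MeasurableSpace Y]
    [MeasurableSpace Z] (P : Measure X) (S : X → Y) (hS : Measurable S) (κ : Kernel Y Z) :
    (P.map S).bind κ = P.bind (κ.comap S hS) := by
  ext A hA
  rw [Measure.bind_apply hA κ.measurable.aemeasurable,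
    Measure.bind_apply hA (κ.comap S hS).measurable.aemeasurable,
    lintegral_map (κ.measurable_coe hA) hS]
  rfl

theorem isProbabilityMeasure_dataLaw (μ : Measure ℝ) [IsProbabilityMeasure μ] (σ : ℝ) {d : ℕ}
    (θ : Fin d → ℝ) : IsProbabilityMeasure (dataLaw μ σ θ) :=
  Measure.isProbabilityMeasure_map (by fun_prop)

/-! ### The lower bound -/

/-- `χ²`-divergences of the releases of one data holder, for a mean that vanishes except at `j`. -/
theorem exists_release_chiSq_bound {c cp : ℝ} (hc : 0 < c) (hcp : 0 < cp) {μ : Measure ℝ}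
    (hμ : IsNoiseLaw c cp μ) {σ : ℝ} (hσ : 0 < σ) {d : ℕ} {a α : ℝ} (ha : 0 < a) (hα : 0 ≤ α)
    (κ : Kernel (Fin d → ℝ) (Fin d → ℝ)) [IsMarkovKernel κ]
    (hκ : ∀ x x' A, MeasurableSet A → κ x A ≤ ENNReal.ofReal (Real.exp α) * κ x' A) :
    ∃ (h : Fin d → (Fin d → ℝ) → ℝ≥0∞) (V : Fin d → ℝ), (∀ j, Measurable (h j)) ∧
      (∀ j, (dataLaw μ σ (Pi.single j a)).bind κ = ((dataLaw μ σ 0).bind κ).withDensity (h j)) ∧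
      (∀ j, ∫⁻ z, h j z ^ 2 ∂((dataLaw μ σ 0).bind κ) ≤ ENNReal.ofReal (1 + V j)) ∧
      (∀ j, 0 ≤ V j) ∧
      ∑ j, V j ≤ (Real.exp α - 1) ^ 2 * (Real.exp (cp * (a / σ) ^ 2) - 1) := by
  have hprob := hμ.isProbability
  obtain ⟨r, hrm, hr0, hmap, hr2, hr1, hchi⟩ := hμ.exists_translate_density hc (a / σ)
  set P := Measure.pi (fun _ : Fin d => μ) with hP
  have hS : Measurable fun ξ : Fin d → ℝ => σ • ξ := by fun_prop
  have hmp : ∀ j : Fin d, MeasurePreserving (fun x : Fin d → ℝ => x j) P μ := fun j =>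
    measurePreserving_eval (fun _ => μ) j
  have hev : ∀ (j : Fin d) (g : ℝ → ℝ), Measurable g → ∫ x, g (x j) ∂P = ∫ x, g x ∂μ := by
    intro j g hg
    rw [← (hmp j).map_eq, integral_map (hmp j).measurable.aemeasurable hg.aestronglyMeasurable]
  have hG : 0 < Real.exp (cp * (a / σ) ^ 2) - 1 :=
    sub_pos.2 (Real.one_lt_exp_iff.2 (by positivity))
  have hrm1 : Measurable fun x => r x - 1 := hrm.sub_const 1
  have hr10 : ∫ x, (r x - 1) ∂μ = 0 := by
    have hri : Integrable r μ :=
      ((hr2.integrable one_le_two).add (integrable_const (1 : ℝ))).congr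
        (Eventually.of_forall fun x => by simp)
    rw [integral_sub hri (integrable_const _), hr1]; simp
  have hind := iIndepFun_pi (μ := fun _ : Fin d => μ) (X := fun _ x => r x - 1)
    (fun _ => hrm1.aemeasurable)
  obtain ⟨h, V, hhm, hbind, hsq, hV0, hV⟩ := exists_chiSq_bound_of_private
    (κ.comap _ hS) hα (fun x x' A hA => hκ _ _ A hA) P (fun j x => r (x j))
    (fun j => hrm.comp (measurable_pi_apply j)) (fun j x => hr0 _)
    (fun j => by rw [hev j r hrm, hr1])
    (fun j => hr2.comp_measurePreserving (hmp j)) hG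
    (fun j k hjk => by
      have := (hind.indepFun hjk).integral_fun_mul_eq_mul_integral
        (hrm1.comp (measurable_pi_apply j)).aestronglyMeasurable
        (hrm1.comp (measurable_pi_apply k)).aestronglyMeasurable
      rw [← hP] at this
      rw [this, hev j (fun x => r x - 1) hrm1, hr10, zero_mul])
    (fun j => by
      rw [hev j (fun x => (r x - 1) * (r x - 1)) (hrm1.mul hrm1)]; exact hchi)
  have h0 : (dataLaw μ σ 0).bind κ = P.bind (κ.comap _ hS) := by
    rw [dataLaw_zero, bind_map_eq_bind_comap _ _ hS]
  refine ⟨h, V, hhm, fun j => ?_, fun j => ?_, hV0, hV⟩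
  · rw [dataLaw_single μ hσ.ne' j a r hrm hmap, bind_map_eq_bind_comap _ _ hS, h0]
    exact hbind j
  · rw [h0]; exact hsq j

theorem hammingDist_eq_sum {d : ℕ} (x y : Fin d → Bool) :
    (hammingDist x y : ℝ≥0∞) = ∑ j, if x j ≠ y j then 1 else 0 := by
  rw [hammingDist, Finset.card_filter]
  push_cast
  rfl

theorem measurableSet_selector_eq {n d : ℕ} (T : Selector n d) (j : Fin d) (v : Bool) :
    MeasurableSet {z | T.toFun z j ≠ v} :=
  ((measurable_pi_apply j).comp T.measurable_toFun) (measurableSet_singleton v).compl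

/-- The expected Hamming loss is the sum of the error probabilities of the components. -/
theorem lintegral_hammingDist {n d : ℕ} (T : Selector n d) (v : Fin d → Bool)
    (ν : Measure (Fin n → Fin d → ℝ)) :
    ∫⁻ z, (hammingDist (T.toFun z) v : ℝ≥0∞) ∂ν = ∑ j, ν {z | T.toFun z j ≠ v j} := by
  simp_rw [hammingDist_eq_sum]
  have hm := fun j => measurableSet_selector_eq T j (v j)
  rw [lintegral_finsetSum _ fun j _ => Measurable.ite (hm j) measurable_const measurable_const]
  refine Finset.sum_congr rfl fun j _ => ?_
  rw [← lintegral_indicator_one (hm j)]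
  refine lintegral_congr fun z => ?_
  by_cases hz : T.toFun z j = v j <;> simp [hz]

/-- If the total `χ²`-information is at most `d log d / 2`, then some coordinate `j` has both a
false-positive probability of order `1 / d` and `χ²`-information at most `log d`; by Cauchy–Schwarz
the presence of a signal in that coordinate goes undetected. -/
theorem quarter_le_maxRisk {c cp : ℝ} (hc : 0 < c) (hcp : 0 < cp) {μ : Measure ℝ}
    (hμ : IsNoiseLaw c cp μ) {σ : ℝ} (hσ : 0 < σ) {n d s : ℕ} (hd : 2 ≤ d) (hs : 1 ≤ s)
    {a α : ℝ} (ha : 0 < a) (hα : 0 ≤ α)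
    (hbound : n * ((Real.exp α - 1) ^ 2 * (Real.exp (cp * (a / σ) ^ 2) - 1)) ≤ d * Real.log d / 2)
    (Q : Mechanism n d α) (T : Selector n d) :
    ENNReal.ofReal (1 / 4) ≤ maxRisk μ σ Q T (sparsePos d s a) := by
  have hprob := hμ.isProbability
  have hdl := fun θ : Fin d → ℝ => isProbabilityMeasure_dataLaw μ σ θ
  have hQm := Q.markov
  by_contra! hlt
  have hd0 : (0 : ℝ) < d := by positivity
  have hlog : 0 < Real.log d := Real.log_pos (by exact_mod_cast hd)
  choose h V hhm hbind hsq hV0 hV using fun i : Fin n =>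
    exists_release_chiSq_bound hc hcp hμ hσ (d := d) ha hα (Q.kernel i) (Q.ldp i)
  set R := fun θ : Fin d → ℝ => releaseLaw μ σ Q θ with hR
  have hRp : ∀ θ, IsProbabilityMeasure (R θ) := fun θ => by
    simp only [hR, releaseLaw]; infer_instance
  have hrisk : ∀ θ ∈ sparsePos d s a, ∑ j, R θ {z | T.toFun z j ≠ supportVec θ j}
      < ENNReal.ofReal (1 / 4) := fun θ hθ => by
    refine lt_of_le_of_lt ?_ hlt
    rw [← lintegral_hammingDist]
    exact le_iSup₂ (f := fun θ (_ : θ ∈ sparsePos d s a) =>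
      ∫⁻ z, (hammingDist (T.toFun z) (supportVec θ) : ℝ≥0∞) ∂(releaseLaw μ σ Q θ)) θ hθ
  set A : Fin d → Set (Fin n → Fin d → ℝ) := fun j => {z | T.toFun z j ≠ false} with hA
  have hAm : ∀ j, MeasurableSet (A j) := fun j => measurableSet_selector_eq T j false
  -- The false positives under the zero mean.
  have hnull : ∑ j, (R 0).real (A j) ≤ 1 / 4 := by
    have h0 := hrisk 0 ⟨∅, by simp, by simp, by simp⟩
    have h1 : ∀ j : Fin d, supportVec (0 : Fin d → ℝ) j = false := by simp [supportVec]
    simp only [h1] at h0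
    simp only [Measure.real]
    rw [← ENNReal.toReal_sum fun j _ => measure_ne_top _ _]
    exact ENNReal.toReal_le_of_le_ofReal (by norm_num) h0.le
  -- The true positive when the signal sits in the coordinate `j`.
  have hpow : ∀ j, 3 / 4 ≤ (R (Pi.single j a)).real (A j) := by
    intro j
    have h0 := hrisk (Pi.single j a) ⟨{j}, by simpa using hs, by simp, by
      intro k hk; simp only [Finset.mem_singleton] at hk; simp [hk]⟩
    have h1 : supportVec (Pi.single j a : Fin d → ℝ) j = true := by simp [supportVec, ha.ne']
    have h2 := (Finset.single_le_sum (f := fun k => R (Pi.single j a)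
      {z | T.toFun z k ≠ supportVec (Pi.single j a : Fin d → ℝ) k})
      (fun k _ => zero_le) (Finset.mem_univ j)).trans h0.le
    have h3 : {z | T.toFun z j ≠ true} = (A j)ᶜ := by
      ext z; simp [hA]
    simp only [h1, h3] at h2
    have h4 := ENNReal.toReal_le_of_le_ofReal (by norm_num) h2
    have h5 := probReal_compl_eq_one_sub (μ := R (Pi.single j a)) (hAm j)
    simp only [Measure.real] at h4 h5 ⊢
    linarith
  set W : Fin d → ℝ := fun j => ∑ i, V i j with hW
  have hW0 : ∀ j, 0 ≤ W j := fun j => Finset.sum_nonneg fun i _ => hV0 i j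
  have hWs : ∑ j, W j ≤ d * Real.log d / 2 := by
    rw [hW, Finset.sum_comm]
    refine (Finset.sum_le_sum fun i _ => hV i).trans ?_
    simpa using hbound
  -- Each of the two terms sums to at most `d`, so some coordinate has their sum at most `2`.
  obtain ⟨j, -, hj⟩ : ∃ j ∈ (Finset.univ : Finset (Fin d)),
      4 * d * (R 0).real (A j) + 2 * W j / Real.log d ≤ 2 := by
    have : NeZero d := ⟨by omega⟩
    refine Finset.exists_le_of_sum_le ⟨0, Finset.mem_univ _⟩ ?_
    rw [Finset.sum_add_distrib, ← Finset.mul_sum, ← Finset.sum_div, ← Finset.mul_sum]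
    have h2 : (2 * ∑ j, W j) / Real.log d ≤ d := by
      rw [div_le_iff₀ hlog]; linarith
    have h3 : 4 * d * ∑ j, (R 0).real (A j) ≤ d := by nlinarith
    simp only [Finset.sum_const, Finset.card_univ, Fintype.card_fin, nsmul_eq_mul]
    linarith
  have hpj : d * (R 0).real (A j) ≤ 1 / 2 := by
    have : 0 ≤ 2 * W j / Real.log d := div_nonneg (by linarith [hW0 j]) hlog.le
    linarith
  have hWj : W j ≤ Real.log d := by
    have h1 : 0 ≤ 4 * d * (R 0).real (A j) := by positivity
    have h2 : 2 * W j / Real.log d ≤ 2 := by linarith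
    rw [div_le_iff₀ hlog] at h2
    linarith
  have hM : ∀ i, IsProbabilityMeasure (((dataLaw μ σ 0).bind (Q.kernel i)).withDensity (h i j)) :=
    fun i => by rw [← hbind i j]; infer_instance
  have hcs := pi_withDensity_sq_le (fun i => (dataLaw μ σ 0).bind (Q.kernel i)) (fun i => h i j)
    (fun i => hhm i j) (hAm j)
  have hprodle : ∏ i, ∫⁻ z, h i j z ^ 2 ∂((dataLaw μ σ 0).bind (Q.kernel i))
      ≤ ENNReal.ofReal d := by
    calc _ ≤ ∏ i, ENNReal.ofReal (Real.exp (V i j)) :=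
          Finset.prod_le_prod' fun i _ => (hsq i j).trans
            (ENNReal.ofReal_le_ofReal (by linarith [Real.add_one_le_exp (V i j)]))
      _ = ENNReal.ofReal (Real.exp (W j)) := by
          rw [← ENNReal.ofReal_prod_of_nonneg fun i _ => (Real.exp_pos _).le, ← Real.exp_sum]
      _ ≤ ENNReal.ofReal d := by
          refine ENNReal.ofReal_le_ofReal ?_
          rw [← Real.exp_log hd0]
          exact Real.exp_le_exp.2 hWj
  have hcs2 : (R (Pi.single j a) (A j)) ^ 2 ≤ R 0 (A j) * ENNReal.ofReal d := by
    have e1 : R (Pi.single j a) = Measure.pi (fun i =>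
        ((dataLaw μ σ 0).bind (Q.kernel i)).withDensity (h i j)) := by
      simp only [hR, releaseLaw]
      congr 1
      ext1 i
      exact hbind i j
    rw [e1]
    exact hcs.trans (mul_le_mul_right hprodle _)
  have hcs3 : (R (Pi.single j a)).real (A j) ^ 2 ≤ (R 0).real (A j) * d := by
    have := ENNReal.toReal_mono (ENNReal.mul_ne_top (measure_ne_top _ _) ENNReal.ofReal_ne_top) hcs2
    rwa [ENNReal.toReal_pow, ENNReal.toReal_mul, ENNReal.toReal_ofReal hd0.le] at this
  nlinarith [hpow j]

theorem sparsePos_subset_sparseAbs {d s : ℕ} {a : ℝ} : sparsePos d s a ⊆ sparseAbs d s a :=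
  fun _ ⟨S, h1, h2, h3⟩ => ⟨S, h1, fun j hj => (h2 j hj).trans (le_abs_self _), h3⟩

theorem maxRisk_mono (μ : Measure ℝ) (σ : ℝ) {n d : ℕ} {α : ℝ} (Q : Mechanism n d α)
    (T : Selector n d) {Θ Θ' : Set (Fin d → ℝ)} (h : Θ ⊆ Θ') :
    maxRisk μ σ Q T Θ ≤ maxRisk μ σ Q T Θ' :=
  biSup_mono fun _ hθ => h hθ

/-- Below the critical value the total `χ²`-information is at most `d log d / 2`. -/
theorem information_le_of_le_criticalValue {cp σ a α : ℝ} {n d : ℕ} (hcp : 0 < cp)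
    (hcp2 : 2 ≤ Real.exp cp)
    (hσ : 0 < σ) (ha : 0 < a) (hα : 0 < α) (hα1 : α ≤ 1) (hd : 2 ≤ d)
    (hlarge : 1 ≤ (n : ℝ) * α ^ 2 / d / Real.log d) (hle : a ≤ criticalValue σ cp n α d) :
    n * ((Real.exp α - 1) ^ 2 * (Real.exp (cp * (a / σ) ^ 2) - 1)) ≤ d * Real.log d / 2 := by
  have hd0 : (0 : ℝ) < d := by positivity
  have hlog : 0 < Real.log d := Real.log_pos (by exact_mod_cast hd)
  set L := (Real.exp (2 * cp) - 1) / 2 with hL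
  have hexp2 : Real.exp (2 * cp) = Real.exp cp ^ 2 := by rw [← Real.exp_nat_mul]; norm_num
  have hL1 : 1 ≤ L := by rw [hL, hexp2]; nlinarith
  have hL2 : Real.exp cp - 1 ≤ L := by rw [hL, hexp2]; nlinarith
  have hN : d * Real.log d ≤ n * α ^ 2 := by
    rw [div_div, le_div_iff₀ (by positivity)] at hlarge
    linarith
  have hNpos : 0 < (n : ℝ) * α ^ 2 := lt_of_lt_of_le (by positivity) hN
  have hb : a / σ ≤ 1 / (16 * L) * √(d * Real.log d / (n * α ^ 2)) := by
    rw [div_le_iff₀ hσ]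
    refine hle.trans_eq ?_
    rw [criticalValue, ← hL]; ring
  have hb0 : 0 < a / σ := by positivity
  have hb2 : (a / σ) ^ 2 ≤ 1 / (256 * L ^ 2) * (d * Real.log d / (n * α ^ 2)) := by
    calc (a / σ) ^ 2 ≤ (1 / (16 * L) * √(d * Real.log d / (n * α ^ 2))) ^ 2 := by gcongr
      _ = _ := by rw [mul_pow, Real.sq_sqrt (by positivity), div_pow, mul_pow]; norm_num
  have hb1 : (a / σ) ^ 2 ≤ 1 := by
    refine hb2.trans ?_
    have h1 : d * Real.log d / (n * α ^ 2) ≤ 1 := (div_le_one hNpos).2 hN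
    have h2 : 1 / (256 * L ^ 2) ≤ 1 := by
      rw [div_le_one (by positivity)]; nlinarith
    exact mul_le_one₀ h2 (by positivity) h1
  -- By convexity `exp (cp t) - 1 ≤ t (exp cp - 1)` for `t ∈ [0, 1]`.
  have hchi : Real.exp (cp * (a / σ) ^ 2) - 1 ≤ (a / σ) ^ 2 * L := by
    have := convexOn_exp.2 (Set.mem_univ cp) (Set.mem_univ 0) (sq_nonneg (a / σ))
      (sub_nonneg.2 hb1) (add_sub_cancel _ _)
    simp only [smul_eq_mul, mul_zero, add_zero, Real.exp_zero, mul_one] at this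
    rw [mul_comm cp]
    nlinarith [mul_le_mul_of_nonneg_left hL2 (sq_nonneg (a / σ))]
  have hα2 : (Real.exp α - 1) ^ 2 ≤ 4 * α ^ 2 := by
    have h1 := Real.abs_exp_sub_one_le (x := α) (by rwa [abs_of_pos hα])
    have h2 := pow_le_pow_left₀ (abs_nonneg _) h1 2
    rw [sq_abs, mul_pow, sq_abs] at h2
    linarith
  have hchi1 : 0 ≤ Real.exp (cp * (a / σ) ^ 2) - 1 :=
    sub_nonneg.2 (Real.one_le_exp (by positivity))
  have hchi0 : 0 ≤ (a / σ) ^ 2 * L := by positivity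
  calc n * ((Real.exp α - 1) ^ 2 * (Real.exp (cp * (a / σ) ^ 2) - 1))
      ≤ n * (4 * α ^ 2 * ((a / σ) ^ 2 * L)) := by gcongr
    _ ≤ n * (4 * α ^ 2 * (1 / (256 * L ^ 2) * (d * Real.log d / (n * α ^ 2)) * L)) := by gcongr
    _ = 1 / (64 * L) * (d * Real.log d) := by
        have hn0 : (n : ℝ) ≠ 0 := by
          rintro h; simp [h] at hNpos
        field_simp
        norm_num
    _ ≤ d * Real.log d / 2 := by
        have h2 : 1 / (64 * L) ≤ 1 / 2 := by
          rw [div_le_div_iff₀ (by positivity) (by norm_num)]; linarith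
        nlinarith [mul_le_mul_of_nonneg_right h2 (by positivity : 0 ≤ d * Real.log d)]

theorem impossible_of_quarter_le {μ : Measure ℝ} {σ : ℝ} {n : ℕ → ℕ} {α : ℕ → ℝ}
    {Θ : ∀ d : ℕ, Set (Fin d → ℝ)}
    (h : ∀ᶠ d in atTop, ∀ (Q : Mechanism (n d) d (α d)) (T : Selector (n d) d),
      ENNReal.ofReal (1 / 4) ≤ maxRisk μ σ Q T (Θ d)) :
    ExactRecoveryImpossible μ σ n α Θ := by
  refine lt_of_lt_of_le (ENNReal.ofReal_pos.2 (by norm_num : (0 : ℝ) < 1 / 4))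
    (le_liminf_of_le (by isBoundedDefault) ?_)
  filter_upwards [h] with d hd
  exact le_iInf fun Q => le_iInf fun T => le_iInf fun _ => hd Q T

theorem impossible_below_criticalValue {c cp σ : ℝ} (hc : 0 < c) (hcp : 0 < cp) (hσ : 0 < σ)
    {μ : Measure ℝ} (hμ : IsNoiseLaw c cp μ) {n s : ℕ → ℕ} (hs : ∀ d, 1 ≤ d → 1 ≤ s d)
    {α : ℕ → ℝ} (hα : ∀ d, 0 < α d ∧ α d ≤ 1)
    (hlog : Tendsto (fun d : ℕ => (n d : ℝ) * α d ^ 2 / d / Real.log d) atTop atTop)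
    {a : ℕ → ℝ} (ha : ∀ d, 0 < a d)
    (hle : ∀ᶠ d in atTop, a d ≤ criticalValue σ cp (n d) (α d) d) :
    ∀ᶠ d in atTop, ∀ (Q : Mechanism (n d) d (α d)) (T : Selector (n d) d),
      ENNReal.ofReal (1 / 4) ≤ maxRisk μ σ Q T (sparsePos d (s d) (a d)) := by
  filter_upwards [hle, eventually_ge_atTop 2, hlog.eventually_ge_atTop 1] with d h1 h2 h3 Q T
  exact quarter_le_maxRisk hc hcp hμ hσ h2 (hs d (by omega)) (ha d) (hα d).1.le
    (information_le_of_le_criticalValue hcp (hμ.two_le_exp hc) hσ (ha d) (hα d).1 (hα d).2 h2 h3 h1)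
    Q T

/-! ### Randomised response -/

/-- The law of a vector equal to `v` with probability `p` and to `-v` with probability `1 - p`. -/
noncomputable def signLaw {d : ℕ} (p : ℝ) (v : Fin d → ℝ) : Measure (Fin d → ℝ) :=
  ENNReal.ofReal p • Measure.dirac v + ENNReal.ofReal (1 - p) • Measure.dirac (-v)

theorem isProbabilityMeasure_signLaw {d : ℕ} {p : ℝ} (h0 : 0 ≤ p) (h1 : p ≤ 1)
    (v : Fin d → ℝ) : IsProbabilityMeasure (signLaw p v) := by
  constructor
  simp only [signLaw, Measure.add_apply, Measure.smul_apply, measure_univ, smul_eq_mul, mul_one]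
  rw [← ENNReal.ofReal_add h0 (by linarith)]
  simp

theorem integral_signLaw {d : ℕ} {p : ℝ} (h0 : 0 ≤ p) (h1 : p ≤ 1) (v : Fin d → ℝ) (j : Fin d) :
    ∫ z, z j ∂(signLaw p v) = (2 * p - 1) * v j := by
  rw [signLaw, integral_add_measure, integral_smul_measure, integral_smul_measure,
    integral_dirac, integral_dirac, ENNReal.toReal_ofReal h0, ENNReal.toReal_ofReal (by linarith)]
  · simp only [smul_eq_mul, Pi.neg_apply]; ring
  · exact (integrable_dirac (by simp)).smul_measure ENNReal.ofReal_ne_top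
  · exact (integrable_dirac (by simp)).smul_measure ENNReal.ofReal_ne_top

theorem ae_signLaw_mem_Icc {d : ℕ} (p : ℝ) (v : Fin d → ℝ) (j : Fin d) (hv : |v j| ≤ 1) :
    ∀ᵐ z ∂(signLaw p v), z j ∈ Set.Icc (-1 : ℝ) 1 := by
  have hm : MeasurableSet {z : Fin d → ℝ | z j ∈ Set.Icc (-1 : ℝ) 1} :=
    measurable_pi_apply j measurableSet_Icc
  rw [abs_le] at hv
  rw [signLaw, ae_add_measure_iff]
  constructor
  · refine Measure.ae_smul_measure ?_ _
    rw [ae_dirac_iff hm]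
    exact hv
  · refine Measure.ae_smul_measure ?_ _
    rw [ae_dirac_iff hm]
    exact ⟨by simp only [Pi.neg_apply]; linarith, by simp only [Pi.neg_apply]; linarith⟩

/-- Data vectors whose coordinate assigned to the data holder `i`, namely `i % d`, is positive. -/
def positiveAt (d i : ℕ) : Set (Fin d → ℝ) := {x | ∃ j : Fin d, i % d = j ∧ 0 < x j}

/-- The indicator vector of the coordinate `i % d` assigned to the data holder `i`. -/
noncomputable def assignedVec (d i : ℕ) : Fin d → ℝ := fun j => if i % d = j then 1 else 0

theorem measurableSet_positiveAt (d i : ℕ) : MeasurableSet (positiveAt d i) := by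
  have : positiveAt d i = ⋃ j : Fin d, {x | i % d = j ∧ 0 < x j} := by
    ext x; simp [positiveAt]
  rw [this]
  refine MeasurableSet.iUnion fun j => MeasurableSet.inter (MeasurableSet.const _) ?_
  exact measurableSet_lt measurable_const (measurable_pi_apply j)

/-- The probability `exp α / (exp α + 1)` of a truthful answer. -/
noncomputable def truthProb (α : ℝ) : ℝ := Real.exp α / (Real.exp α + 1)

theorem truthProb_pos (α : ℝ) : 0 < truthProb α := by unfold truthProb; positivity

theorem one_sub_truthProb (α : ℝ) : 1 - truthProb α = 1 / (Real.exp α + 1) := by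
  have := Real.exp_pos α
  unfold truthProb; field_simp; ring

theorem truthProb_lt_one (α : ℝ) : truthProb α < 1 := by
  have h : 0 < 1 - truthProb α := by rw [one_sub_truthProb]; positivity
  linarith

theorem div_four_le_two_mul_truthProb_sub_one {α : ℝ} (h0 : 0 < α) (h1 : α ≤ 1) :
    α / 4 ≤ 2 * truthProb α - 1 := by
  have h3 : Real.exp α ≤ 3 := (Real.exp_le_exp.2 h1).trans Real.exp_one_lt_three.le
  have h4 := Real.add_one_le_exp α
  have : 2 * truthProb α - 1 = (Real.exp α - 1) / (Real.exp α + 1) := by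
    unfold truthProb; field_simp; ring
  rw [this, div_le_div_iff₀ (by norm_num) (by positivity)]
  nlinarith

theorem signLaw_le {d : ℕ} (v : Fin d → ℝ) {p q C : ℝ} (hC : 0 ≤ C) (h1 : p ≤ C * q)
    (h2 : 1 - p ≤ C * (1 - q)) (A : Set (Fin d → ℝ)) :
    signLaw p v A ≤ ENNReal.ofReal C * signLaw q v A := by
  simp only [signLaw, Measure.add_apply, Measure.smul_apply, smul_eq_mul, mul_add, ← mul_assoc]
  rw [← ENNReal.ofReal_mul hC, ← ENNReal.ofReal_mul hC]
  gcongr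

open Classical in
/-- Randomised response: the data holder reports the sign of the coordinate `i % d`, truthfully
with probability `truthProb α`, and zero in every other coordinate. -/
noncomputable def responseKernel (d i : ℕ) (α : ℝ) : Kernel (Fin d → ℝ) (Fin d → ℝ) :=
  Kernel.piecewise (measurableSet_positiveAt d i)
    (Kernel.const _ (signLaw (truthProb α) (assignedVec d i)))
    (Kernel.const _ (signLaw (1 - truthProb α) (assignedVec d i)))

theorem responseKernel_apply_mem {d i : ℕ} {α : ℝ} {x : Fin d → ℝ} (hx : x ∈ positiveAt d i) :
    responseKernel d i α x = signLaw (truthProb α) (assignedVec d i) := by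
  simp [responseKernel, Kernel.piecewise_apply, hx]

theorem responseKernel_apply_notMem {d i : ℕ} {α : ℝ} {x : Fin d → ℝ}
    (hx : x ∉ positiveAt d i) :
    responseKernel d i α x = signLaw (1 - truthProb α) (assignedVec d i) := by
  simp [responseKernel, Kernel.piecewise_apply, hx]

theorem isMarkovKernel_responseKernel (d i : ℕ) (α : ℝ) :
    IsMarkovKernel (responseKernel d i α) := by
  have h0 := (truthProb_pos α).le
  have h1 := (truthProb_lt_one α).le
  refine ⟨fun x => ?_⟩
  by_cases hx : x ∈ positiveAt d i
  · rw [responseKernel_apply_mem hx]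
    exact isProbabilityMeasure_signLaw h0 h1 _
  · rw [responseKernel_apply_notMem hx]
    exact isProbabilityMeasure_signLaw (by linarith) (by linarith) _

theorem responseKernel_ldp (d i : ℕ) {α : ℝ} (hα : 0 ≤ α) (x x' : Fin d → ℝ)
    (A : Set (Fin d → ℝ)) :
    responseKernel d i α x A ≤ ENNReal.ofReal (Real.exp α) * responseKernel d i α x' A := by
  have he : 1 ≤ Real.exp α := Real.one_le_exp hα
  have h0 := truthProb_pos α
  have h1 : 0 < 1 - truthProb α := by linarith [truthProb_lt_one α]
  have h2 : truthProb α = Real.exp α * (1 - truthProb α) := by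
    rw [one_sub_truthProb]; unfold truthProb; ring
  have h3 : 1 - truthProb α ≤ Real.exp α * truthProb α := by nlinarith
  have key : ∀ y, ∃ p, (p = truthProb α ∨ p = 1 - truthProb α) ∧
      responseKernel d i α y = signLaw p (assignedVec d i) := fun y => by
    by_cases hy : y ∈ positiveAt d i
    · exact ⟨_, Or.inl rfl, responseKernel_apply_mem hy⟩
    · exact ⟨_, Or.inr rfl, responseKernel_apply_notMem hy⟩
  obtain ⟨p, hp, hp'⟩ := key x
  obtain ⟨q, hq, hq'⟩ := key x'
  rw [hp', hq']
  rcases hp with rfl | rfl <;> rcases hq with rfl | rfl <;>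
    refine signLaw_le _ (Real.exp_pos α).le ?_ ?_ A <;> nlinarith

/-- The mechanism in which the data holder `i` spends the whole privacy budget on a randomised
response about the coordinate `i % d`. -/
noncomputable def responseMechanism (n d : ℕ) {α : ℝ} (hα : 0 ≤ α) : Mechanism n d α where
  kernel i := responseKernel d i α
  markov i := isMarkovKernel_responseKernel d i α
  ldp i x x' A _ := responseKernel_ldp d i hα x x' A

/-- The released law is again a random sign, biased by the truth probability. -/
theorem bind_responseKernel {d : ℕ} (i : ℕ) (α : ℝ) (P : Measure (Fin d → ℝ))
    [IsProbabilityMeasure P] :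
    P.bind (responseKernel d i α) = signLaw
      (P.real (positiveAt d i) * truthProb α + (1 - P.real (positiveAt d i)) * (1 - truthProb α))
      (assignedVec d i) := by
  have h0 := (truthProb_pos α).le
  have h1 : 0 ≤ 1 - truthProb α := by linarith [truthProb_lt_one α]
  have hB := measurableSet_positiveAt d i
  set w := P.real (positiveAt d i) with hw
  have hw0 : 0 ≤ w := measureReal_nonneg
  have hw1 : 0 ≤ 1 - w := sub_nonneg.2 measureReal_le_one
  have hPB : P (positiveAt d i) = ENNReal.ofReal w := (ofReal_measureReal).symm
  have hPBc : P (positiveAt d i)ᶜ = ENNReal.ofReal (1 - w) := by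
    rw [hw, ← probReal_compl_eq_one_sub hB, ofReal_measureReal]
  ext A hA
  rw [Measure.bind_apply hA (Kernel.measurable _).aemeasurable, ← lintegral_add_compl _ hB,
    setLIntegral_congr_fun hB (fun x hx => by rw [responseKernel_apply_mem hx]),
    setLIntegral_congr_fun hB.compl (fun x hx => by rw [responseKernel_apply_notMem hx]),
    setLIntegral_const, setLIntegral_const, hPB, hPBc]
  simp only [signLaw, Measure.add_apply, Measure.smul_apply, smul_eq_mul]
  rw [show 1 - (w * truthProb α + (1 - w) * (1 - truthProb α))
      = w * (1 - truthProb α) + (1 - w) * truthProb α by ring,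
    show 1 - (1 - truthProb α) = truthProb α by ring,
    ENNReal.ofReal_add (by positivity) (by positivity),
    ENNReal.ofReal_add (by positivity) (by positivity),
    ENNReal.ofReal_mul hw0, ENNReal.ofReal_mul hw1, ENNReal.ofReal_mul hw0,
    ENNReal.ofReal_mul hw1]
  ring

/-! ### Concentration of the sums of signs -/

/-- Two-sided Hoeffding inequality for one coordinate of independent random vectors. -/
theorem measureReal_abs_sum_sub_ge_le {n d : ℕ} (ν : Fin n → Measure (Fin d → ℝ))
    [∀ i, IsProbabilityMeasure (ν i)] (j : Fin d) (C : Finset (Fin n)) (m : ℝ)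
    (hν : ∀ i ∈ C, ∀ᵐ z ∂(ν i), z j ∈ Set.Icc (-1 : ℝ) 1) (hm : ∀ i ∈ C, ∫ z, z j ∂(ν i) = m)
    {ε : ℝ} (hε : 0 ≤ ε) :
    (Measure.pi ν).real {z | ε ≤ |∑ i ∈ C, z i j - C.card * m|}
      ≤ 2 * Real.exp (-ε ^ 2 / (2 * C.card)) := by
  have hmp := fun i => measurePreserving_eval ν i
  have hcm : Measurable fun x : Fin d → ℝ => x j := measurable_pi_apply j
  have hsub : ∀ i ∈ C, HasSubgaussianMGF (fun z : Fin n → Fin d → ℝ => z i j - m) 1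
      (Measure.pi ν) := by
    intro i hi
    have hae : ∀ᵐ z ∂(Measure.pi ν), z i j ∈ Set.Icc (-1 : ℝ) 1 :=
      (hmp i).quasiMeasurePreserving.ae (hν i hi)
    have h := hasSubgaussianMGF_of_mem_Icc (X := fun z : Fin n → Fin d → ℝ => z i j)
      (hcm.comp (measurable_pi_apply i)).aemeasurable hae
    have hmean : ∫ z, z i j ∂(Measure.pi ν) = m := by
      rw [← hm i hi, ← (hmp i).map_eq, integral_map (hmp i).measurable.aemeasurable
        hcm.aestronglyMeasurable]
    rw [hmean] at h
    convert h using 1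
    ext
    norm_num
  have hind : iIndepFun (fun i (z : Fin n → Fin d → ℝ) => z i j - m) (Measure.pi ν) :=
    iIndepFun_pi (X := fun _ (x : Fin d → ℝ) => x j - m)
      (fun _ => (hcm.sub_const m).aemeasurable)
  have hind' : iIndepFun (fun i (z : Fin n → Fin d → ℝ) => -(z i j - m)) (Measure.pi ν) :=
    iIndepFun_pi (X := fun _ (x : Fin d → ℝ) => -(x j - m))
      (fun _ => (hcm.sub_const m).neg.aemeasurable)
  have h1 := HasSubgaussianMGF.measure_sum_ge_le_of_iIndepFun hind hsub hε
  have h2 := HasSubgaussianMGF.measure_sum_ge_le_of_iIndepFun hind'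
    (fun i hi => (hsub i hi).neg) hε
  simp only [Finset.sum_const, nsmul_eq_mul, mul_one, NNReal.coe_natCast] at h1 h2
  have hsum : ∀ z : Fin n → Fin d → ℝ, ∑ i ∈ C, (z i j - m) = ∑ i ∈ C, z i j - C.card * m :=
    fun z => by rw [Finset.sum_sub_distrib]; simp
  have hincl : {z : Fin n → Fin d → ℝ | ε ≤ |∑ i ∈ C, z i j - C.card * m|}
      ⊆ {z | ε ≤ ∑ i ∈ C, (z i j - m)} ∪ {z | ε ≤ ∑ i ∈ C, -(z i j - m)} := by
    intro z hz
    simp only [Set.mem_union, Set.mem_ofPred_eq, Finset.sum_neg_distrib, hsum] at hz ⊢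
    exact le_abs.1 hz
  calc _ ≤ _ := measureReal_mono hincl
    _ ≤ _ := measureReal_union_le _ _
    _ ≤ _ := by linarith

/-- The expected sign of `t + σ ξ` vanishes for `t = 0` and is otherwise at least of the order of
`min (|t| / σ) 1`: the density of the noise is bounded below on `[0, 1]` because the potential,
being convex, is bounded above there. -/
theorem IsNoiseLaw.exists_sign_mean_bound {c cp : ℝ} {μ : Measure ℝ} (hc : 0 < c)
    (hμ : IsNoiseLaw c cp μ) : ∃ k : ℝ, 0 < k ∧ ∀ σ : ℝ, 0 < σ →
      2 * μ.real {ξ | 0 < 0 + σ * ξ} - 1 = 0 ∧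
      ∀ t : ℝ, k * min (|t| / σ) 1 ≤ |2 * μ.real {ξ | 0 < t + σ * ξ} - 1| := by
  have hprob := hμ.isProbability
  obtain ⟨φ, hφc, -, hφ⟩ := hμ.potential
  have hconv : ConvexOn ℝ Set.univ φ := hφc.convexOn fun r => by positivity
  have hac : μ ≪ volume := by rw [hφ]; exact withDensity_absolutelyContinuous _ _
  have hna : ∀ x, μ {x} = 0 := fun x => hac (by simp)
  set H : ℝ → ℝ := fun u => μ.real (Set.Ioi (-u)) with hH
  have hsymm : ∀ u, H u = μ.real (Set.Iic u) := by
    intro u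
    have h1 : μ (Set.Ioi (-u)) = μ (Set.Iio u) := by
      conv_lhs => rw [← hμ.symmetric]
      rw [Measure.map_apply (by fun_prop) measurableSet_Ioi]
      congr 1; ext x; simp
    have h2 : μ (Set.Iio u) = μ (Set.Iic u) := by
      rw [← Set.Iio_union_right]
      refine le_antisymm (measure_mono Set.subset_union_left) ?_
      exact (measure_union_le _ _).trans (by rw [hna, add_zero])
    simp only [hH, Measure.real, h1, h2]
  have hadd : ∀ u, H u + H (-u) = 1 := by
    intro u
    rw [hsymm u]
    simp only [hH, neg_neg]
    rw [← Set.compl_Iic, probReal_compl_eq_one_sub measurableSet_Iic]; ring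
  set k := Real.exp (-max (φ 0) (φ 1)) with hk
  have hk0 : 0 < k := Real.exp_pos _
  have hdens : ∀ x ∈ Set.Icc (0 : ℝ) 1, k ≤ Real.exp (-φ x) := by
    intro x hx
    refine Real.exp_le_exp.2 (neg_le_neg ?_)
    exact hconv.le_max_of_mem_Icc (Set.mem_univ _) (Set.mem_univ _) hx
  have hpos : ∀ u, 0 ≤ u → k * min u 1 ≤ 2 * H u - 1 := by
    intro u hu
    have hv0 : 0 ≤ min u 1 := le_min hu zero_le_one
    have h1 : 2 * H u - 1 = μ.real (Set.Ioc (-u) u) := by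
      have : H u = μ.real (Set.Ioc (-u) u) + H (-u) := by
        simp only [hH, neg_neg]
        rw [← measureReal_union _ measurableSet_Ioi, Set.Ioc_union_Ioi_eq_Ioi (by linarith)]
        rw [Set.disjoint_left]
        intro x hx hx'
        exact absurd hx.2 (not_le.2 hx')
      linarith [hadd u]
    have h2 : ENNReal.ofReal (k * min u 1) ≤ μ (Set.Ioc 0 (min u 1)) := by
      have hA : MeasurableSet (Set.Ioc (0 : ℝ) (min u 1)) := measurableSet_Ioc
      conv_rhs => rw [hφ]
      rw [withDensity_apply _ hA]
      calc ENNReal.ofReal (k * min u 1)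
          = ∫⁻ _ in Set.Ioc (0 : ℝ) (min u 1), ENNReal.ofReal k := by
            rw [setLIntegral_const, Real.volume_Ioc, sub_zero, ENNReal.ofReal_mul hk0.le]
        _ ≤ _ := setLIntegral_mono' hA fun x hx =>
            ENNReal.ofReal_le_ofReal (hdens x ⟨hx.1.le, hx.2.trans (min_le_right _ _)⟩)
    have h3 : k * min u 1 ≤ μ.real (Set.Ioc 0 (min u 1)) :=
      (ENNReal.ofReal_le_iff_le_toReal (measure_ne_top _ _)).1 h2
    rw [h1]
    refine h3.trans (measureReal_mono fun x hx => ⟨by linarith [hx.1], ?_⟩)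
    exact hx.2.trans (min_le_left _ _)
  refine ⟨k, hk0, fun σ hσ => ?_⟩
  have hset : ∀ t : ℝ, μ.real {ξ | 0 < t + σ * ξ} = H (t / σ) := by
    intro t
    simp only [hH]
    congr 1
    ext ξ
    simp only [Set.mem_ofPred_eq, Set.mem_Ioi]
    rw [← neg_div, div_lt_iff₀ hσ]
    constructor <;> intro h <;> linarith
  refine ⟨?_, fun t => ?_⟩
  · rw [hset, zero_div]
    have := hadd 0
    rw [neg_zero] at this
    linarith
  · rw [hset]
    have habs : |2 * H (t / σ) - 1| = |2 * H (|t| / σ) - 1| := by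
      rcases abs_cases t with ⟨h, -⟩ | ⟨h, -⟩
      · rw [h]
      · rw [h, neg_div, ← abs_neg]
        congr 1
        linarith [hadd (t / σ)]
    rw [habs]
    exact (hpos _ (by positivity)).trans (le_abs_self _)

/-! ### The upper bound -/

/-- The data holders assigned to the coordinate `j`. -/
def assigned (n d : ℕ) (j : Fin d) : Finset (Fin n) := {i : Fin n | (i : ℕ) % d = j}

theorem div_le_card_assigned (n d : ℕ) (j : Fin d) : n / d ≤ (assigned n d j).card := by
  have hd : 0 < d := j.pos
  have hlt : ∀ k : Fin (n / d), (k : ℕ) * d + j < n := fun k => by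
    have h1 : ((k : ℕ) + 1) * d ≤ n / d * d := Nat.mul_le_mul_right d k.isLt
    have h2 := Nat.div_mul_le_self n d
    have h3 := j.isLt
    rw [Nat.add_mul, one_mul] at h1
    omega
  have hcard : (Finset.univ : Finset (Fin (n / d))).card = n / d := by simp
  rw [← hcard]
  refine Finset.card_le_card_of_injOn (fun k => ⟨k * d + j, hlt k⟩) (fun k _ => ?_) ?_
  · simp [assigned, Nat.mod_eq_of_lt j.isLt]
  · intro k _ l _ hkl
    simp only [Fin.mk.injEq, add_left_inj] at hkl
    exact Fin.ext (Nat.eq_of_mul_eq_mul_right hd hkl)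

/-- The selector that declares a coordinate active when the answers about it are unbalanced, their
mean exceeding `τ` in absolute value. -/
noncomputable def thresholdSelector (n d : ℕ) (τ : ℝ) : Selector n d where
  toFun z j := decide ((assigned n d j).card * τ < |∑ i ∈ assigned n d j, z i j|)
  measurable_toFun := by
    refine measurable_pi_iff.2 fun j => measurable_to_bool ?_
    have : (fun z : Fin n → Fin d → ℝ =>
        decide ((assigned n d j).card * τ < |∑ i ∈ assigned n d j, z i j|)) ⁻¹' {true}
        = {z | (assigned n d j).card * τ < |∑ i ∈ assigned n d j, z i j|} := by
      ext z; simp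
    rw [this]
    have hm : Measurable fun z : Fin n → Fin d → ℝ => ∑ i ∈ assigned n d j, z i j :=
      Finset.measurable_sum _ fun i _ => (measurable_pi_apply j).comp (measurable_pi_apply i)
    exact measurableSet_lt measurable_const (continuous_abs.measurable.comp hm)

theorem dataLaw_real_positiveAt (μ : Measure ℝ) [IsProbabilityMeasure μ] (σ : ℝ) {d : ℕ}
    (θ : Fin d → ℝ) {i : ℕ} {j : Fin d} (hij : i % d = j) :
    (dataLaw μ σ θ).real (positiveAt d i) = μ.real {ξ | 0 < θ j + σ * ξ} := by
  have hm : MeasurableSet {ξ : ℝ | 0 < θ j + σ * ξ} :=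
    measurableSet_lt measurable_const (by fun_prop)
  have hpre : (fun ξ : Fin d → ℝ => θ + σ • ξ) ⁻¹' positiveAt d i
      = (fun ξ : Fin d → ℝ => ξ j) ⁻¹' {ξ : ℝ | 0 < θ j + σ * ξ} := by
    ext ξ
    simp only [positiveAt, Set.mem_preimage, Set.mem_ofPred_eq, Pi.add_apply, Pi.smul_apply,
      smul_eq_mul]
    constructor
    · rintro ⟨k, hk, h⟩
      have : k = j := Fin.ext (hk.symm.trans hij)
      rwa [← this]
    · exact fun h => ⟨j, hij, h⟩
  rw [Measure.real, dataLaw, Measure.map_apply (by fun_prop) (measurableSet_positiveAt d i), hpre,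
    (measurePreserving_eval (fun _ : Fin d => μ) j).measure_preimage hm.nullMeasurableSet]
  rfl

/-- Error probability of one component of the threshold selector: with truth bias `β` and mean
signs of size at least `2 γ` on the support, the threshold `β γ` is at distance at least `β γ` from
the mean answer under both hypotheses. -/
theorem releaseLaw_error_le {μ : Measure ℝ} [IsProbabilityMeasure μ] {σ : ℝ} {n d : ℕ} {α γ : ℝ}
    (hα : 0 < α) (hα1 : α ≤ 1) (hγ : 0 ≤ γ) (hd : d ≤ n) (θ : Fin d → ℝ) (j : Fin d)
    (h0 : θ j = 0 → 2 * μ.real {ξ | 0 < θ j + σ * ξ} - 1 = 0)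
    (h1 : θ j ≠ 0 → 2 * γ ≤ |2 * μ.real {ξ | 0 < θ j + σ * ξ} - 1|) :
    releaseLaw μ σ (responseMechanism n d hα.le) θ
      {z | (thresholdSelector n d ((2 * truthProb α - 1) * γ)).toFun z j ≠ supportVec θ j}
      ≤ ENNReal.ofReal (2 * Real.exp (-(n * α ^ 2 / d * γ ^ 2 / 64))) := by
  have hdl := isProbabilityMeasure_dataLaw μ σ θ
  set β := 2 * truthProb α - 1 with hβ
  have hβα : α / 4 ≤ β := div_four_le_two_mul_truthProb_sub_one hα hα1
  have hβ0 : 0 < β := by linarith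
  set w := μ.real {ξ | 0 < θ j + σ * ξ} with hw
  have hw0 : 0 ≤ w := measureReal_nonneg
  have hw1 : w ≤ 1 := measureReal_le_one
  set C := assigned n d j with hC
  set ν : Fin n → Measure (Fin d → ℝ) := fun i => (dataLaw μ σ θ).bind (responseKernel d i α)
    with hν
  have hmk := fun i => isMarkovKernel_responseKernel d i α
  have hνp : ∀ i, IsProbabilityMeasure (ν i) := fun i => by simp only [hν]; infer_instance
  have hrel : releaseLaw μ σ (responseMechanism n d hα.le) θ = Measure.pi ν := rfl
  have hp0 := truthProb_pos α
  have hp1 := truthProb_lt_one α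
  have hCi : ∀ i ∈ C, (i : ℕ) % d = j := fun i hi => by simpa [hC, assigned] using hi
  have hνC : ∀ i ∈ C, ν i = signLaw (w * truthProb α + (1 - w) * (1 - truthProb α))
      (assignedVec d i) := fun i hi => by
    simp only [hν]
    rw [bind_responseKernel, dataLaw_real_positiveAt μ σ θ (hCi i hi)]
  have hvec : ∀ i ∈ C, assignedVec d i j = 1 := fun i hi => by
    simp [assignedVec, hCi i hi]
  have hoeff := measureReal_abs_sum_sub_ge_le ν j C (β * (2 * w - 1))
    (fun i hi => by
      rw [hνC i hi]
      exact ae_signLaw_mem_Icc _ _ _ (by rw [hvec i hi, abs_one]))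
    (fun i hi => by
      rw [hνC i hi, integral_signLaw (by nlinarith) (by nlinarith), hvec i hi, hβ]; ring)
    (ε := C.card * (β * γ)) (by positivity)
  have hcard : n / d ≤ C.card := div_le_card_assigned n d j
  have hd0 : 0 < d := j.pos
  have hd0' : (0 : ℝ) < d := by exact_mod_cast hd0
  have hCpos : (0 : ℝ) < C.card := by
    exact_mod_cast lt_of_lt_of_le (Nat.div_pos hd hd0) hcard
  -- Since `d ≤ n`, rounding down `n / d` loses at most a factor `2`.
  have hCn : (n : ℝ) / (2 * d) ≤ C.card := by
    rw [div_le_iff₀ (by positivity)]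
    have h2 : n < d * (n / d + 1) := Nat.lt_mul_div_succ n hd0
    have h3 : 1 ≤ n / d := Nat.div_pos hd hd0
    have h4 : n ≤ C.card * (2 * d) := by nlinarith
    exact_mod_cast h4
  have hincl : {z : Fin n → Fin d → ℝ |
      (thresholdSelector n d (β * γ)).toFun z j ≠ supportVec θ j}
      ⊆ {z | C.card * (β * γ) ≤ |∑ i ∈ C, z i j - C.card * (β * (2 * w - 1))|} := by
    intro z hz
    simp only [Set.mem_ofPred_eq, thresholdSelector, supportVec, ← hC] at hz ⊢
    by_cases hθ : θ j = 0
    · simp only [hθ, ne_eq, not_true_eq_false, decide_false, decide_eq_false_iff_not,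
        not_not] at hz
      rw [h0 hθ]
      simpa using hz.le
    · simp only [hθ, ne_eq, not_false_eq_true, decide_true, decide_eq_true_eq, not_lt] at hz
      have h2 : C.card * (β * (2 * γ)) ≤ |C.card * (β * (2 * w - 1))| := by
        rw [abs_mul, abs_mul, abs_of_pos hCpos, abs_of_pos hβ0]
        have := h1 hθ
        gcongr
      have h3 := abs_sub_abs_le_abs_sub (C.card * (β * (2 * w - 1))) (∑ i ∈ C, z i j)
      rw [abs_sub_comm] at h3
      linarith
  rw [hrel, ← ofReal_measureReal (μ := Measure.pi ν)]
  refine ENNReal.ofReal_le_ofReal ((measureReal_mono hincl).trans (hoeff.trans ?_))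
  have hexp : n * α ^ 2 / d * γ ^ 2 / 64 ≤ (C.card * (β * γ)) ^ 2 / (2 * C.card) := by
    have h2 : (α / 4) ^ 2 ≤ β ^ 2 := by gcongr
    calc n * α ^ 2 / d * γ ^ 2 / 64 = n / (2 * d) * ((α / 4) ^ 2 * γ ^ 2) / 2 := by
          field_simp; ring
      _ ≤ C.card * (β ^ 2 * γ ^ 2) / 2 := by gcongr
      _ = _ := by field_simp
  gcongr
  rw [neg_div]
  exact neg_le_neg hexp

/-- The risk of the threshold selector applied to randomised responses. -/
theorem maxRisk_response_le {c cp : ℝ} {μ : Measure ℝ} (hμ : IsNoiseLaw c cp μ) {k σ : ℝ}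
    (hk : 0 < k) (hσ : 0 < σ) (hzero : 2 * μ.real {ξ | 0 < 0 + σ * ξ} - 1 = 0)
    (hmean : ∀ t : ℝ, k * min (|t| / σ) 1 ≤ |2 * μ.real {ξ | 0 < t + σ * ξ} - 1|)
    {n d s : ℕ} {a α : ℝ} (hα : 0 < α) (hα1 : α ≤ 1) (ha : 0 < a) (hdn : d ≤ n)
    (hlarge : 2 * Real.log d ≤ n * α ^ 2 / d * (k * min (a / σ) 1 / 2) ^ 2 / 64) :
    maxRisk μ σ (responseMechanism n d hα.le)
      (thresholdSelector n d ((2 * truthProb α - 1) * (k * min (a / σ) 1 / 2)))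
      (sparseAbs d s a) ≤ ENNReal.ofReal (2 / d) := by
  have hprob := hμ.isProbability
  refine iSup₂_le fun θ hθ => ?_
  obtain ⟨S, -, hS1, hS0⟩ := hθ
  have hγ : 0 ≤ k * min (a / σ) 1 / 2 := by positivity
  rw [lintegral_hammingDist]
  calc _ ≤ ∑ _j : Fin d, ENNReal.ofReal (2 * Real.exp (-(2 * Real.log d))) := by
        refine Finset.sum_le_sum fun j _ => ?_
        refine (releaseLaw_error_le hα hα1 hγ hdn θ j (fun h => ?_) fun h => ?_).trans ?_
        · rw [h]; exact hzero
        · have hj : j ∈ S := by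
            by_contra hj; exact h (hS0 j hj)
          refine le_trans ?_ (hmean (θ j))
          rw [mul_div_cancel₀ _ (two_ne_zero' ℝ)]
          have := hS1 j hj
          gcongr
        · gcongr
    _ = ENNReal.ofReal (d * (2 * Real.exp (-(2 * Real.log d)))) := by
        rw [Finset.sum_const, Finset.card_univ, Fintype.card_fin, nsmul_eq_mul,
          ENNReal.ofReal_mul (Nat.cast_nonneg _), ENNReal.ofReal_natCast]
    _ ≤ ENNReal.ofReal (2 / d) := by
        rcases Nat.eq_zero_or_pos d with hd | hd
        · simp [hd]
        · have hd' : (0 : ℝ) < d := by exact_mod_cast hd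
          refine ENNReal.ofReal_le_ofReal (le_of_eq ?_)
          rw [Real.exp_neg, two_mul (Real.log _), Real.exp_add, Real.exp_log hd']
          field_simp

/-- Far above the critical value the exponent of the error probabilities exceeds `2 log d`. -/
theorem log_le_of_criticalValue_le {cp σ a α k ρ : ℝ} {n d : ℕ} (hcp : 0 < cp) (hσ : 0 < σ)
    (hk : 0 < k) (hd : 2 ≤ d)
    (hρ : ρ = 16 * ((Real.exp (2 * cp) - 1) / 2) * √(512 / k ^ 2))
    (hlarge : 512 / k ^ 2 ≤ (n : ℝ) * α ^ 2 / d / Real.log d)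
    (hle : ρ ≤ a / criticalValue σ cp n α d) :
    2 * Real.log d ≤ n * α ^ 2 / d * (k * min (a / σ) 1 / 2) ^ 2 / 64 := by
  have hd0 : (0 : ℝ) < d := by positivity
  have hlog : 0 < Real.log d := Real.log_pos (by exact_mod_cast hd)
  have hL : 0 < (Real.exp (2 * cp) - 1) / 2 := by
    have := Real.one_lt_exp_iff.2 (by positivity : 0 < 2 * cp)
    linarith
  set L := (Real.exp (2 * cp) - 1) / 2 with hLdef
  rw [le_div_iff₀ hlog] at hlarge
  set N := (n : ℝ) * α ^ 2 / d with hN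
  have hN0 : 0 < N := lt_of_lt_of_le (by positivity) hlarge
  have hNeq : (d : ℝ) * Real.log d / (n * α ^ 2) = Real.log d / N := by
    have : (n : ℝ) * α ^ 2 = N * d := by rw [hN]; field_simp
    rw [this]; field_simp
  have hmin : 512 / k ^ 2 * Real.log d ≤ N * min (a / σ) 1 ^ 2 := by
    rcases le_total 1 (a / σ) with h | h
    · rw [min_eq_right h]; linarith
    · rw [min_eq_left h]
      have hcrit : criticalValue σ cp n α d = σ / (16 * L) * √(Real.log d / N) := by
        rw [criticalValue, hNeq]
      have hcpos : 0 < criticalValue σ cp n α d := by rw [hcrit]; positivity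
      rw [le_div_iff₀ hcpos, hcrit, hρ] at hle
      have hb : √(512 / k ^ 2) * √(Real.log d / N) ≤ a / σ := by
        rw [le_div_iff₀ hσ]
        refine le_trans (le_of_eq ?_) hle
        field_simp
      have hb2 : 512 / k ^ 2 * (Real.log d / N) ≤ (a / σ) ^ 2 := by
        calc 512 / k ^ 2 * (Real.log d / N)
            = (√(512 / k ^ 2) * √(Real.log d / N)) ^ 2 := by
              rw [mul_pow, Real.sq_sqrt (by positivity), Real.sq_sqrt (by positivity)]
          _ ≤ _ := by gcongr
      calc 512 / k ^ 2 * Real.log d = N * (512 / k ^ 2 * (Real.log d / N)) := by field_simp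
        _ ≤ _ := by gcongr
  calc 2 * Real.log d = k ^ 2 / 256 * (512 / k ^ 2 * Real.log d) := by field_simp; norm_num
    _ ≤ k ^ 2 / 256 * (N * min (a / σ) 1 ^ 2) := by gcongr
    _ = _ := by ring

/-- Far above the critical value one mechanism and selector recover the support over the two-sided
class, uniformly in the sparsity. -/
theorem possible_above_criticalValue {c cp σ : ℝ} (hc : 0 < c) (hcp : 0 < cp) (hσ : 0 < σ)
    {μ : Measure ℝ} (hμ : IsNoiseLaw c cp μ) {n : ℕ → ℕ} (s : ℕ → ℕ)
    {α : ℕ → ℝ} (hα : ∀ d, 0 < α d ∧ α d ≤ 1)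
    (hn : Tendsto (fun d : ℕ => (n d : ℝ) * α d ^ 2 / d) atTop atTop)
    (hlog : Tendsto (fun d : ℕ => (n d : ℝ) * α d ^ 2 / d / Real.log d) atTop atTop)
    {a : ℕ → ℝ} (ha : ∀ d, 0 < a d)
    (hratio : Tendsto (fun d => a d / criticalValue σ cp (n d) (α d) d) atTop atTop) :
    ExactRecoveryPossible μ σ n α (fun d => sparseAbs d (s d) (a d)) := by
  obtain ⟨k, hk, hsign⟩ := hμ.exists_sign_mean_bound hc
  obtain ⟨hzero, hmean⟩ := hsign σ hσ
  refine ⟨fun d => responseMechanism (n d) d (hα d).1.le, fun d => thresholdSelector (n d) d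
    ((2 * truthProb (α d) - 1) * (k * min (a d / σ) 1 / 2)), ?_⟩
  have hlim : Tendsto (fun d : ℕ => ENNReal.ofReal (2 / d)) atTop (𝓝 0) := by
    rw [← ENNReal.ofReal_zero]
    exact ENNReal.tendsto_ofReal (tendsto_const_div_atTop_nhds_zero_nat 2)
  set ρ := 16 * ((Real.exp (2 * cp) - 1) / 2) * √(512 / k ^ 2) with hρ
  refine tendsto_of_tendsto_of_tendsto_of_le_of_le' tendsto_const_nhds hlim
    (Eventually.of_forall fun d => zero_le) ?_
  filter_upwards [eventually_ge_atTop 2, hn.eventually_ge_atTop 1,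
    hlog.eventually_ge_atTop (512 / k ^ 2), hratio.eventually_ge_atTop ρ] with d h2 h3 h4 h5
  have hdn : d ≤ n d := by
    have hd0 : (0 : ℝ) < d := by positivity
    rw [le_div_iff₀ hd0, one_mul] at h3
    have hα2 : α d ^ 2 ≤ 1 := pow_le_one₀ (hα d).1.le (hα d).2
    have : (d : ℝ) ≤ n d := h3.trans (mul_le_of_le_one_right (Nat.cast_nonneg _) hα2)
    exact_mod_cast this
  exact maxRisk_response_le hμ hk hσ hzero hmean (hα d).1 (hα d).2 (ha d) hdn
    (log_le_of_criticalValue_le hcp hσ hk h2 hρ h4 h5)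

end PrivateSupport

theorem mainTheorem11 (c cp σ : ℝ) (hc : 0 < c) (hcp : 0 < cp) (hσ : 0 < σ)
    (μ : Measure ℝ) (hμ : IsNoiseLaw c cp μ)
    (n s : ℕ → ℕ) (hs : ∀ d, 1 ≤ d → 1 ≤ s d ∧ s d ≤ d)
    (α : ℕ → ℝ) (hα : ∀ d, 0 < α d ∧ α d ≤ 1)
    (hn : Tendsto (fun d : ℕ => (n d : ℝ) * α d ^ 2 / d) atTop atTop)
    (hlog : Tendsto (fun d : ℕ => (n d : ℝ) * α d ^ 2 / d / Real.log d) atTop atTop) :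
    (∀ a : ℕ → ℝ, (∀ d, 0 < a d) →
      (∀ᶠ d in atTop, a d ≤ criticalValue σ cp (n d) (α d) d) →
        ExactRecoveryImpossible μ σ n α (fun d => sparsePos d (s d) (a d)) ∧
        ExactRecoveryImpossible μ σ n α (fun d => sparseAbs d (s d) (a d))) ∧
    (∀ a : ℕ → ℝ, (∀ d, 0 < a d) →
      Tendsto (fun d => a d / criticalValue σ cp (n d) (α d) d) atTop atTop →
        ExactRecoveryPossible μ σ n α (fun d => sparsePos d (s d) (a d)) ∧
        ExactRecoveryPossible μ σ n α (fun d => sparseAbs d (s d) (a d))) := by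
  refine ⟨fun a ha hle => ?_, fun a ha hratio => ?_⟩
  · have h := impossible_below_criticalValue hc hcp hσ hμ (fun d hd => (hs d hd).1) hα hlog ha hle
    refine ⟨impossible_of_quarter_le h, impossible_of_quarter_le ?_⟩
    filter_upwards [h] with d hd Q T
    exact (hd Q T).trans (maxRisk_mono μ σ Q T sparsePos_subset_sparseAbs)
  · have h := possible_above_criticalValue hc hcp hσ hμ s hα hn hlog ha hratio
    refine ⟨?_, h⟩
    obtain ⟨Q, T, hQT⟩ := h
    exact ⟨Q, T, tendsto_of_tendsto_of_tendsto_of_le_of_le tendsto_const_nhds hQT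
      (fun d => zero_le) fun d => maxRisk_mono μ σ _ _ sparsePos_subset_sparseAbs⟩
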